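/- Let $G$ and $A$ be probability distributions on $[0,\infty)$ with finite nonzero means. Consider the FIFO $GI/GI/1$ queue with iid service times $S_0,S_1,\dots\sim G$ and, independently, iid interarrival times $T_0,T_1,\dots\sim A$. The arrival epochs are $t_n=T_0+\dots+T_{n-1}$ (so $t_0=0$), and the initial delay $D_0\ge 0$ is a random variable independent of the input. The delays in line satisfy $D_{n+1}=(D_n+S_n-T_n)^+$, and the work in system at time $t\ge 0$ is $V(t)=(D_n+S_n-(t-t_n))^+$ for $t_n\le t<t_{n+1}$. Let $\rho=E(S)/E(T)$ and assume stability, $0<\rho<1$. Let $G_e$ be the equilibrium distribution of $G$, $G_e(x)=\frac{1}{E(S)}\int_0^x P(S>y)\,dy$ for $x\ge 0$. Then there is a unique law of the stationary delay $D$, i.e. a unique probability law on $\mathbb R$ such that $(D+S-T)^+\stackrel{d}{=}D$ when $D,\ S\sim G,\ T\sim A$ are independent, and $D_n$ converges in distribution to $D$. There is also a unique law of the time-stationary workload $V$, given by $$P(V\le x)=\lim_{t\to\infty}\frac1t\int_0^tP(V(s)\le x)\,ds\quad\text{for all } x .$$ Moreover, $G_e$ is a probability distribution and, with $D$ and $S_e\sim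 G_e$ independent, $$P(V>x)=\rho\,P(D+S_e>x),\qquad x\ge 0,$$ that is, $V$ has the law $(1-\rho)\delta_0+\rho\,(F_D*G_e)$, where $F_D$ is the law of $D$. Consequently, if $\rho$ is explicitly known and one can exactly simulate from $D$ and from $G_e$, then one can exactly simulate from $V$. Precisely, the following procedure outputs a value with exactly the law of $V$. It is given the number $\rho$, independent uniform $[0,1]$ random numbers, and independent exact samples of $D$ and $G_e$ on request, and it uses nothing else about the queue. Draw $U$ uniform on $[0,1]$; if $U<\rho$, sample $D$ and, independently, $S_e\sim G_e$, and output $D+S_e$; otherwise output $0$. Equivalently, if $B\sim\mathrm{Bernoulli}(\rho)$, $D$ and $S_e$ are independent, then the variable that equals $D+S_e$ when $B=1$ and $0$ when $B=0$ has the law of $V$. -/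

import Mathlib

open MeasureTheory ProbabilityTheory Filter Topology

noncomputable section

namespace GIGI1

/-! ### The FIFO single-server queue with renewal input -/

/-- Primitive random variables of a FIFO `GI/GI/1` queue on a probability space `(Ω, P)`:
iid service times `S n` with law `G`, independently iid interarrival times `T n` with law `A`,
and an independent nonnegative delay `D₀` of customer `0`, who arrives at time `0`. -/
structure IsInput {Ω : Type*} [MeasurableSpace Ω] (P : Measure Ω) (G A : Measure ℝ)
    (D₀ : Ω → ℝ) (S T : ℕ → Ω → ℝ) : Prop where
  measurable_init : Measurable D₀
  measurable_service : ∀ n, Measurable (S n)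
  measurable_interarrival : ∀ n, Measurable (T n)
  init_nonneg : ∀ᵐ ω ∂P, 0 ≤ D₀ ω
  law_service : ∀ n, P.map (S n) = G
  law_interarrival : ∀ n, P.map (T n) = A
  indep_service : iIndepFun S P
  indep_interarrival : iIndepFun T P
  indep_service_interarrival : IndepFun (fun ω n => S n ω) (fun ω n => T n ω) P
  indep_init : IndepFun D₀ (fun ω => ((fun n => S n ω), (fun n => T n ω))) P

/-- The traffic intensity `ρ = λ E(S) = E(S) / E(T)`. -/
def trafficIntensity (G A : Measure ℝ) : ℝ := (∫ s, s ∂G) / (∫ t, t ∂A)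

/-- Delay in line of the `n`-th customer: `D_{n+1} = (D_n + S_n - T_n)⁺`. -/
def delay {Ω : Type*} (D₀ : Ω → ℝ) (S T : ℕ → Ω → ℝ) : ℕ → Ω → ℝ
  | 0, ω => D₀ ω
  | n + 1, ω => max (delay D₀ S T n ω + S n ω - T n ω) 0

/-- Arrival epochs `t_n = T_0 + ⋯ + T_{n-1}`, `t_0 = 0`. -/
def arrivalTime {Ω : Type*} (T : ℕ → Ω → ℝ) (n : ℕ) (ω : Ω) : ℝ :=
  ∑ i ∈ Finset.range n, T i ω

/-- Index of the last customer that has arrived by time `t ≥ 0`, that is, the `n` with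
`t_n ≤ t < t_{n+1}`. -/
def lastArrival {Ω : Type*} (T : ℕ → Ω → ℝ) (t : ℝ) (ω : Ω) : ℕ :=
  sSup {n : ℕ | arrivalTime T n ω ≤ t}

/-- Work in system at time `t ≥ 0`: `V(t) = (D_n + S_n - (t - t_n))⁺` for `t_n ≤ t < t_{n+1}`. -/
def workload {Ω : Type*} (D₀ : Ω → ℝ) (S T : ℕ → Ω → ℝ) (t : ℝ) (ω : Ω) : ℝ :=
  max (delay D₀ S T (lastArrival T t ω) ω + S (lastArrival T t ω) ω
    - (t - arrivalTime T (lastArrival T t ω) ω)) 0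

/-- The definition of `workload` unfolds to the usual one on each interarrival interval. -/
theorem workload_eq {Ω : Type*} (D₀ : Ω → ℝ) (S T : ℕ → Ω → ℝ) (t : ℝ) (ω : Ω) (n : ℕ)
    (hT : ∀ k, 0 ≤ T k ω) (h₁ : arrivalTime T n ω ≤ t) (h₂ : t < arrivalTime T (n + 1) ω) :
    workload D₀ S T t ω
      = max (delay D₀ S T n ω + S n ω - (t - arrivalTime T n ω)) 0 := by
  have hmono : Monotone fun k => arrivalTime T k ω :=
    monotone_nat_of_le_succ fun k => by
      simp only [arrivalTime, Finset.sum_range_succ]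
      linarith [hT k]
  have hset : {k : ℕ | arrivalTime T k ω ≤ t} = Set.Iic n := by
    ext k
    simp only [Set.mem_ofPred_eq, Set.mem_Iic]
    refine ⟨fun hk => ?_, fun hk => (hmono hk).trans h₁⟩
    by_contra hlt
    exact absurd ((hmono (Nat.succ_le_of_lt (not_le.mp hlt))).trans hk) (not_le.mpr h₂)
  have hlast : lastArrival T t ω = n := by
    rw [lastArrival, hset, csSup_Iic]
  rw [workload, hlast]

/-! ### Stationary laws -/

/-- `δ` is a stationary law of the delay chain: if `D ∼ δ`, `S ∼ G`, `T ∼ A` are independent,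
then `(D + S - T)⁺ ∼ δ`. -/
def IsStationaryDelayLaw (G A : Measure ℝ) (δ : ProbabilityMeasure ℝ) : Prop :=
  Measure.map (fun p : (ℝ × ℝ) × ℝ => max (p.1.1 + p.1.2 - p.2) 0)
    (((δ : Measure ℝ).prod G).prod A) = (δ : Measure ℝ)

/-- `ν` is the law of the time-stationary workload:
`ν (-∞, x] = lim_{t → ∞} (1/t) ∫_0^t P(V(s) ≤ x) ds` for all `x`. -/
def IsTimeStationaryWorkloadLaw {Ω : Type*} [MeasurableSpace Ω] (P : Measure Ω)
    (D₀ : Ω → ℝ) (S T : ℕ → Ω → ℝ) (ν : ProbabilityMeasure ℝ) : Prop :=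
  ∀ x : ℝ, Tendsto
    (fun t : ℝ => (1 / t) * ∫ s in (0 : ℝ)..t, P.real {ω | workload D₀ S T s ω ≤ x})
    atTop (𝓝 ((ν : Measure ℝ).real (Set.Iic x)))

/-- The equilibrium distribution `G_e` of `G`, with density `μ P(S > y)` on `[0, ∞)`, where
`1 / μ = E(S)`; that is, `G_e(x) = μ ∫_0^x P(S > y) dy`. -/
def equilibrium (G : Measure ℝ) : Measure ℝ :=
  (volume.restrict (Set.Ici (0 : ℝ))).withDensity
    fun y => ENNReal.ofReal ((∫ s, s ∂G)⁻¹ * G.real (Set.Ioi y))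

/-! ### Exact simulation

A simulation procedure is a program over real registers. It may draw fresh independent
uniform `[0, 1]` variates, request fresh independent exact samples from given distributions
(indexed by `ι`), branch on comparisons, and output the value of an arithmetic expression.
Nothing else about the given distributions is available to it. -/

/-- Arithmetic expressions in the registers, with rational constants. -/
inductive Expr : Type
  | reg (i : ℕ) : Expr
  | const (q : ℚ) : Expr
  | add (a b : Expr) : Expr
  | sub (a b : Expr) : Expr
  | mul (a b : Expr) : Expr

/-- Value of an expression when the registers contain `m`. -/
def Expr.eval (m : ℕ → ℝ) : Expr → ℝ
  | .reg i => m i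
  | .const q => (q : ℝ)
  | .add a b => a.eval m + b.eval m
  | .sub a b => a.eval m - b.eval m
  | .mul a b => a.eval m * b.eval m

/-- Simulation procedures. -/
inductive Procedure (ι : Type) : Type
  /-- Stop, with the value of `e` as output. -/
  | output (e : Expr) : Procedure ι
  /-- Write a fresh uniform `[0, 1]` variate to register `r` and continue with `p`. -/
  | uniform (r : ℕ) (p : Procedure ι) : Procedure ι
  /-- Write a fresh sample of the distribution number `i` to register `r`, continue with `p`. -/
  | sample (i : ι) (r : ℕ) (p : Procedure ι) : Procedure ι
  /-- Continue with `p` if `a < b`, and with `q` otherwise. -/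
  | ifLt (a b : Expr) (p q : Procedure ι) : Procedure ι

open Classical in
/-- Law of the output of a procedure that has access to the distributions `dist i` and starts
with register contents `m`. -/
def Procedure.outputLaw {ι : Type} (dist : ι → Measure ℝ) :
    Procedure ι → (ℕ → ℝ) → Measure ℝ
  | .output e, m => Measure.dirac (e.eval m)
  | .uniform r p, m => (volume.restrict (Set.Icc (0 : ℝ) 1)).bind
      fun x => p.outputLaw dist (Function.update m r x)
  | .sample i r p, m => (dist i).bind fun x => p.outputLaw dist (Function.update m r x)
  | .ifLt a b p q, m =>
      if a.eval m < b.eval m then p.outputLaw dist m else q.outputLaw dist m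

/-- The two distributions that can be sampled: stationary delay and equilibrium service. -/
inductive Source : Type
  | delay : Source
  | equilibriumService : Source

/-- The distributions behind the two sources. -/
def Source.dist (δ : ProbabilityMeasure ℝ) (G : Measure ℝ) : Source → Measure ℝ
  | .delay => (δ : Measure ℝ)
  | .equilibriumService => equilibrium G

/-- Initial register contents: the known number `ρ` in register `0`, and `0` elsewhere. -/
def known (ρ : ℝ) : ℕ → ℝ := Function.update (fun _ => 0) 0 ρ

/-- The procedure: with probability `ρ` (the content of register `0`) sample `D` and `S_e`
independently and output `D + S_e`; otherwise output `0`. -/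
def workloadProcedure : Procedure Source :=
  .uniform 1 <|
    .ifLt (.reg 1) (.reg 0)
      (.sample .delay 2 <| .sample .equilibriumService 3 <| .output (.add (.reg 2) (.reg 3)))
      (.output (.const 0))

end GIGI1

end

/-!
**The delay.** Let `W_n` be the random walk with steps `S_i - T_i`; by the strong law and `ρ < 1`
it drifts to `-∞`. A delay is `D_n = max (D₀ + W_n) D⁰_n`, where `D⁰` is the delay sequence of an
initially empty queue (`delay_eq_max`), so the initial delay is eventually forgotten. Reversing the
order of the inputs gives `backwardDelay`, with the law of `D⁰_n` but increasing in `n` and bounded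
by the maximum of `W`; hence the laws of `D⁰_n` converge weakly
(`IsInput.exists_isEmptyStartLimit`).
The limit is stationary because the transition operator preserves bounded continuous functions. A
queue started in any other stationary law would converge to the same limit while keeping its law
(`IsInput.eq_of_isStationaryDelayLaw`).

**The workload.** Fix `x ≥ 0` and put `a(v) = (v - x)⁺`. Between arrivals `a(V)` decreases at unit
rate exactly while `V > x`, so the time above `x` up to the arrival epoch `t_m` is
`∑_{n < m} (a(D_n + S_n) - a(D_{n+1}))` (`timeAbove_arrivalTime`), which up to boundary terms is
`∑_{n < m} (a(D_n + S_n) - a(D_n))`. With `m = ⌊t / E(T)⌋` the law of large numbers in mean gives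
`E|t - t_m| = o(t)`. Since `D_n` and `S_n` are independent and `D_n` converges in law, the mean
increments converge to `E(a(D + S) - a(D)) = E(S) P(D + S_e > x)`
(`IsInput.tendsto_integral_increment`, `integral_mul_prod_equilibrium_real`). Therefore the
long-run fraction of time above `x` is `ρ P(D + S_e > x)` (`IsInput.tendsto_average_real_workload`).
The boundary terms need care because delays need not be integrable: from above, `D₀ / t` may be
replaced by its minimum with `1`; from below, `a` is truncated at a level `K`, which tends to
infinity after `t`.

The simulation statements say that a procedure, or a Bernoulli mixture, has the law
`(1 - ρ) δ₀ + ρ (F_D ∗ G_e)`, called `zeroOrSumLaw` below; they follow by computing both sides.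
-/

namespace GIGI1

/-! ### Pathwise properties of delays -/

section Pathwise

variable {Ω : Type*} {D₀ : Ω → ℝ} {S T : ℕ → Ω → ℝ}

/-- The delay of customer `n` in a queue that starts empty and uses the inputs of the customers
`k, …, k + n - 1` in reversed order. By independence it has the law of the delay of customer `n`
in an initially empty queue, and it increases with `n`. -/
def backwardDelay {Ω : Type*} (S T : ℕ → Ω → ℝ) : ℕ → ℕ → Ω → ℝ
  | 0, _, _ => 0
  | n + 1, k, ω => max (backwardDelay S T n (k + 1) ω + S k ω - T k ω) 0

theorem backwardDelay_nonneg (n k : ℕ) (ω : Ω) : 0 ≤ backwardDelay S T n k ω := by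
  cases n with
  | zero => exact le_rfl
  | succ n => exact le_max_right _ _

theorem monotone_backwardDelay (k : ℕ) (ω : Ω) :
    Monotone fun n => backwardDelay S T n k ω := by
  refine monotone_nat_of_le_succ fun n => ?_
  induction n generalizing k with
  | zero => exact backwardDelay_nonneg 1 k ω
  | succ n ih =>
    have := ih (k + 1)
    simp only [backwardDelay] at this ⊢
    gcongr

/-- A backward delay is at most the largest increment from time `k` on of the random walk with
steps `S i - T i`. -/
theorem backwardDelay_le {C : ℝ} {ω : Ω}
    (hC : ∀ n, ∑ i ∈ Finset.range n, (S i ω - T i ω) ≤ C) (n k : ℕ) :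
    backwardDelay S T n k ω ≤ C - ∑ i ∈ Finset.range k, (S i ω - T i ω) := by
  induction n generalizing k with
  | zero => simpa [backwardDelay] using hC k
  | succ n ih =>
    have h := ih (k + 1)
    rw [Finset.sum_range_succ] at h
    exact max_le (by linarith) (by linarith [hC k])

/-- The delay as a function of the initial delay. -/
theorem delay_eq_max {ω : Ω} (h₀ : 0 ≤ D₀ ω) (n : ℕ) :
    delay D₀ S T n ω
      = max (D₀ ω + ∑ i ∈ Finset.range n, (S i ω - T i ω)) (delay (fun _ => 0) S T n ω) := by
  induction n with
  | zero => simp [delay, h₀]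
  | succ n ih =>
    rw [delay, ih, delay, Finset.sum_range_succ, ← max_assoc, ← max_add_add_right,
      ← max_sub_sub_right]
    congr 2
    ring

theorem delay_nonneg {ω : Ω} (h₀ : 0 ≤ D₀ ω) (n : ℕ) : 0 ≤ delay D₀ S T n ω := by
  cases n with
  | zero => exact h₀
  | succ n => exact le_max_right _ _

end Pathwise

/-! ### Independence of the primitive variables -/

/-- All primitive variables of the queue as one family: the initial delay, the service times and
the interarrival times. -/
def input {Ω : Type*} (D₀ : Ω → ℝ) (S T : ℕ → Ω → ℝ) : Unit ⊕ (ℕ ⊕ ℕ) → Ω → ℝ :=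
  Sum.elim (fun _ => D₀) (Sum.elim S T)

/-- The σ-algebra generated by the primitive variables with index in `J`. -/
abbrev inputSigma {Ω : Type*} (D₀ : Ω → ℝ) (S T : ℕ → Ω → ℝ) (J : Set (Unit ⊕ (ℕ ⊕ ℕ))) :
    MeasurableSpace Ω :=
  ⨆ j ∈ J, MeasurableSpace.comap (input D₀ S T j) inferInstance

theorem measurable_input_inputSigma {Ω : Type*} {D₀ : Ω → ℝ} {S T : ℕ → Ω → ℝ}
    {J : Set (Unit ⊕ (ℕ ⊕ ℕ))} {j : Unit ⊕ (ℕ ⊕ ℕ)} (hj : j ∈ J) :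
    Measurable[inputSigma D₀ S T J] (input D₀ S T j) :=
  Measurable.mono (comap_measurable _)
    (le_iSup₂_of_le (f := fun j (_ : j ∈ J) =>
      MeasurableSpace.comap (input D₀ S T j) inferInstance) j hj le_rfl) le_rfl

/-- Two independent families, each consisting of mutually independent variables, form together
a mutually independent family. -/
theorem iIndepFun_sumElim {Ω ι κ β : Type*} [MeasurableSpace Ω] [MeasurableSpace β]
    {P : Measure Ω} {f : ι → Ω → β} {g : κ → Ω → β}
    (hf : iIndepFun f P) (hg : iIndepFun g P)
    (hfg : IndepFun (fun ω i => f i ω) (fun ω j => g j ω) P) :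
    iIndepFun (fun i : ι ⊕ κ => (Sum.elim f g i : Ω → β)) P := by
  rw [iIndepFun_iff_measure_inter_preimage_eq_mul]
  intro s A hA
  have hset : (⋂ i ∈ s, Sum.elim f g i ⁻¹' A i)
      = (fun ω i => f i ω) ⁻¹' (⋂ i ∈ s.toLeft, (fun x => x i) ⁻¹' A (.inl i)) ∩
        (fun ω j => g j ω) ⁻¹' (⋂ j ∈ s.toRight, (fun x => x j) ⁻¹' A (.inr j)) := by
    ext ω
    simp
  have hl : (fun ω i => f i ω) ⁻¹' (⋂ i ∈ s.toLeft, (fun x => x i) ⁻¹' A (.inl i))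
      = ⋂ i ∈ s.toLeft, f i ⁻¹' A (.inl i) := by
    ext ω; simp
  have hr : (fun ω j => g j ω) ⁻¹' (⋂ j ∈ s.toRight, (fun x => x j) ⁻¹' A (.inr j))
      = ⋂ j ∈ s.toRight, g j ⁻¹' A (.inr j) := by
    ext ω; simp
  rw [hset, hfg.measure_inter_preimage_eq_mul, hl, hr,
    hf.measure_inter_preimage_eq_mul (sets := fun i => A (.inl i)),
    hg.measure_inter_preimage_eq_mul (sets := fun j => A (.inr j))]
  · conv_rhs => rw [← Finset.toLeft_disjSum_toRight (u := s), Finset.prod_disjSum]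
    rfl
  · exact fun j hj => hA _ (Finset.mem_toRight.1 hj)
  · exact fun j hj => hA _ (Finset.mem_toLeft.1 hj)
  · exact Finset.measurableSet_biInter _ fun i hi =>
      (measurable_pi_apply i) (hA _ (Finset.mem_toLeft.1 hi))
  · exact Finset.measurableSet_biInter _ fun i hi =>
      (measurable_pi_apply i) (hA _ (Finset.mem_toRight.1 hi))

theorem measurable_delay_inputSigma {Ω : Type*} {D₀ : Ω → ℝ} {S T : ℕ → Ω → ℝ}
    (n : ℕ) :
    Measurable[inputSigma D₀ S T
      {j | j = .inl () ∨ ∃ i < n, j = .inr (.inl i) ∨ j = .inr (.inr i)}] (delay D₀ S T n) := by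
  induction n with
  | zero => exact measurable_input_inputSigma (j := .inl ()) (Or.inl rfl)
  | succ n ih =>
    refine Measurable.max (Measurable.sub (Measurable.add (ih.mono ?_ le_rfl) ?_) ?_)
      measurable_const
    · refine biSup_mono fun j hj => ?_
      rcases hj with hj | ⟨i, hi, hj⟩
      exacts [Or.inl hj, Or.inr ⟨i, by omega, hj⟩]
    · exact measurable_input_inputSigma (j := .inr (.inl n)) (Or.inr ⟨n, by omega, Or.inl rfl⟩)
    · exact measurable_input_inputSigma (j := .inr (.inr n)) (Or.inr ⟨n, by omega, Or.inr rfl⟩)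

theorem measurable_backwardDelay_inputSigma {Ω : Type*} {D₀ : Ω → ℝ} {S T : ℕ → Ω → ℝ}
    (n k : ℕ) :
    Measurable[inputSigma D₀ S T
      {j | ∃ i, k ≤ i ∧ (j = .inr (.inl i) ∨ j = .inr (.inr i))}] (backwardDelay S T n k) := by
  induction n generalizing k with
  | zero => exact measurable_const
  | succ n ih =>
    refine Measurable.max (Measurable.sub (Measurable.add ((ih (k + 1)).mono ?_ le_rfl) ?_) ?_)
      measurable_const
    · refine biSup_mono fun j hj => ?_
      obtain ⟨i, hi, hj⟩ := hj
      exact ⟨i, by omega, hj⟩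
    · exact measurable_input_inputSigma (j := .inr (.inl k)) ⟨k, le_rfl, Or.inl rfl⟩
    · exact measurable_input_inputSigma (j := .inr (.inr k)) ⟨k, le_rfl, Or.inr rfl⟩

section Input

variable {Ω : Type*} [MeasurableSpace Ω] {P : Measure Ω} {G A : Measure ℝ}
  {D₀ : Ω → ℝ} {S T : ℕ → Ω → ℝ}

theorem IsInput.measurable_input (hQ : IsInput P G A D₀ S T) (j : Unit ⊕ (ℕ ⊕ ℕ)) :
    Measurable (input D₀ S T j) := by
  rcases j with _ | j | j
  · exact hQ.measurable_init
  · exact hQ.measurable_service j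
  · exact hQ.measurable_interarrival j

theorem IsInput.inputSigma_le (hQ : IsInput P G A D₀ S T) (J : Set (Unit ⊕ (ℕ ⊕ ℕ))) :
    inputSigma D₀ S T J ≤ ‹MeasurableSpace Ω› :=
  iSup₂_le fun j _ => (hQ.measurable_input j).comap_le

theorem IsInput.iIndepFun_input [IsProbabilityMeasure P] (hQ : IsInput P G A D₀ S T) :
    iIndepFun (input D₀ S T) P := by
  refine iIndepFun_sumElim iIndepFun.of_subsingleton
    (iIndepFun_sumElim hQ.indep_service hQ.indep_interarrival hQ.indep_service_interarrival) ?_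
  have h := hQ.indep_init.comp (φ := fun x (_ : Unit) => x)
    (ψ := fun p (j : ℕ ⊕ ℕ) => (Sum.elim p.1 p.2 j : ℝ)) (by fun_prop) (by
      refine measurable_pi_lambda _ fun j => ?_
      rcases j with j | j
      · exact (measurable_pi_apply j).comp measurable_fst
      · exact (measurable_pi_apply j).comp measurable_snd)
  convert h using 1 <;> (funext ω j; cases j <;> rfl)

/-- Functions of disjoint groups of primitive variables are independent. -/
theorem IsInput.indepFun [IsProbabilityMeasure P] (hQ : IsInput P G A D₀ S T)
    {J K : Set (Unit ⊕ (ℕ ⊕ ℕ))} (hJK : Disjoint J K) {β γ : Type*} [MeasurableSpace β]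
    [MeasurableSpace γ] {f : Ω → β} {g : Ω → γ} (hf : Measurable[inputSigma D₀ S T J] f)
    (hg : Measurable[inputSigma D₀ S T K] g) : IndepFun f g P := by
  rw [IndepFun_iff_Indep]
  refine indep_of_indep_of_le_left (indep_of_indep_of_le_right ?_ hg.comap_le) hf.comap_le
  exact indep_iSup_of_disjoint (fun j => (hQ.measurable_input j).comap_le)
    hQ.iIndepFun_input.iIndep hJK

/-! ### The transition operator of the delay chain -/

/-- One step of the delay chain on laws: the law of `(D + S - T)⁺` for independent `D ∼ μ`,
`S ∼ G`, `T ∼ A`. -/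
noncomputable def delayStep (G A μ : Measure ℝ) : Measure ℝ :=
  Measure.map (fun p : (ℝ × ℝ) × ℝ => max (p.1.1 + p.1.2 - p.2) 0) ((μ.prod G).prod A)

theorem IsInput.map_prodMk_service [IsProbabilityMeasure P] (hQ : IsInput P G A D₀ S T)
    {J : Set (Unit ⊕ (ℕ ⊕ ℕ))} {Z : Ω → ℝ} {k : ℕ} (hZ : Measurable[inputSigma D₀ S T J] Z)
    (hS : .inr (.inl k) ∉ J) : P.map (fun ω => (Z ω, S k ω)) = (P.map Z).prod G := by
  have h := hQ.indepFun (K := {.inr (.inl k)}) (by simpa using hS) hZ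
    (measurable_input_inputSigma (Set.mem_singleton _))
  rw [← hQ.law_service k]
  exact (indepFun_iff_map_prod_eq_prod_map_map
    (hZ.mono (hQ.inputSigma_le J) le_rfl).aemeasurable
    (hQ.measurable_service k).aemeasurable).1 h

theorem IsInput.map_max_add_sub [IsProbabilityMeasure P] (hQ : IsInput P G A D₀ S T)
    {J : Set (Unit ⊕ (ℕ ⊕ ℕ))} {Z : Ω → ℝ} {k : ℕ} (hZ : Measurable[inputSigma D₀ S T J] Z)
    (hS : .inr (.inl k) ∉ J) (hT : .inr (.inr k) ∉ J) :
    P.map (fun ω => max (Z ω + S k ω - T k ω) 0) = delayStep G A (P.map Z) := by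
  have hZ' : Measurable Z := hZ.mono (hQ.inputSigma_le J) le_rfl
  have hmS := hQ.measurable_service k
  have hmT := hQ.measurable_interarrival k
  have hpair : Measurable[inputSigma D₀ S T (insert (.inr (.inl k)) J)]
      (fun ω => (Z ω, S k ω)) := by
    refine Measurable.prodMk (hZ.mono ?_ le_rfl) (measurable_input_inputSigma (Set.mem_insert _ _))
    exact biSup_mono fun j hj => Set.mem_insert_of_mem _ hj
  have h := hQ.indepFun (K := {.inr (.inr k)}) (by simpa using hT) hpair
    (measurable_input_inputSigma (Set.mem_singleton _))
  have h' := (indepFun_iff_map_prod_eq_prod_map_map (hZ'.prodMk hmS).aemeasurable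
    hmT.aemeasurable).1 h
  rw [hQ.map_prodMk_service hZ hS, hQ.law_interarrival k] at h'
  rw [delayStep, ← h', Measure.map_map (by fun_prop) (by fun_prop)]
  rfl

theorem IsInput.measurable_delay (hQ : IsInput P G A D₀ S T) (n : ℕ) :
    Measurable (delay D₀ S T n) :=
  (measurable_delay_inputSigma n).mono (hQ.inputSigma_le _) le_rfl

theorem IsInput.map_delay_succ [IsProbabilityMeasure P] (hQ : IsInput P G A D₀ S T) (n : ℕ) :
    P.map (delay D₀ S T (n + 1)) = delayStep G A (P.map (delay D₀ S T n)) :=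
  hQ.map_max_add_sub (measurable_delay_inputSigma n) (by simp) (by simp)

theorem IsInput.map_delay_service [IsProbabilityMeasure P] (hQ : IsInput P G A D₀ S T) (n : ℕ) :
    P.map (fun ω => (delay D₀ S T n ω, S n ω)) = (P.map (delay D₀ S T n)).prod G :=
  hQ.map_prodMk_service (measurable_delay_inputSigma n) (by simp)

theorem IsInput.measurable_backwardDelay (hQ : IsInput P G A D₀ S T) (n k : ℕ) :
    Measurable (backwardDelay S T n k) :=
  (measurable_backwardDelay_inputSigma (D₀ := D₀) n k).mono (hQ.inputSigma_le _) le_rfl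

theorem IsInput.map_backwardDelay_succ [IsProbabilityMeasure P] (hQ : IsInput P G A D₀ S T)
    (n k : ℕ) : P.map (backwardDelay S T (n + 1) k)
      = delayStep G A (P.map (backwardDelay S T n (k + 1))) :=
  hQ.map_max_add_sub (measurable_backwardDelay_inputSigma n (k + 1)) (by simp) (by simp)

/-- The initial delay may be replaced by `0`. -/
theorem IsInput.zero_init [IsProbabilityMeasure P] (hQ : IsInput P G A D₀ S T) :
    IsInput P G A (fun _ => 0) S T where
  measurable_init := measurable_const
  measurable_service := hQ.measurable_service
  measurable_interarrival := hQ.measurable_interarrival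
  init_nonneg := by simp
  law_service := hQ.law_service
  law_interarrival := hQ.law_interarrival
  indep_service := hQ.indep_service
  indep_interarrival := hQ.indep_interarrival
  indep_service_interarrival := hQ.indep_service_interarrival
  indep_init := indepFun_const_left _ _

theorem IsInput.map_backwardDelay [IsProbabilityMeasure P] (hQ : IsInput P G A D₀ S T)
    (n k : ℕ) : P.map (backwardDelay S T n k) = P.map (delay (fun _ => 0) S T n) := by
  induction n generalizing k with
  | zero => rfl
  | succ n ih => rw [hQ.map_backwardDelay_succ, hQ.zero_init.map_delay_succ, ih]

end Input

/-! ### The stationary delay -/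

section Average

variable {Ω : Type*} [MeasurableSpace Ω] {P : Measure Ω} {μ : Measure ℝ} {X : ℕ → Ω → ℝ}

theorem ae_tendsto_average (hX : ∀ n, Measurable (X n)) (hlaw : ∀ n, P.map (X n) = μ)
    (hind : iIndepFun X P) (hint : Integrable (fun x => x) μ) :
    ∀ᵐ ω ∂P, Tendsto (fun n : ℕ => (∑ i ∈ Finset.range n, X i ω) / n) atTop
      (𝓝 (∫ x, x ∂μ)) := by
  have hint0 : Integrable (X 0) P := by
    rw [← hlaw 0] at hint
    exact hint.comp_measurable (hX 0)
  have h := strong_law_ae_real X hint0 (fun i j hij => hind.indepFun hij)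
    (fun i => ⟨(hX i).aemeasurable, (hX 0).aemeasurable, by rw [hlaw, hlaw]⟩)
  rwa [← hlaw 0, integral_map (hX 0).aemeasurable (by fun_prop)]

theorem tendsto_integral_abs_average_sub [IsProbabilityMeasure P] (hX : ∀ n, Measurable (X n))
    (hlaw : ∀ n, P.map (X n) = μ) (hind : iIndepFun X P) (hint : Integrable (fun x => x) μ) :
    Tendsto (fun n : ℕ => ∫ ω, |(n : ℝ)⁻¹ * (∑ i ∈ Finset.range n, X i ω) - ∫ x, x ∂μ| ∂P)
      atTop (𝓝 0) := by
  have hint0 : Integrable (X 0) P := by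
    rw [← hlaw 0] at hint
    exact hint.comp_measurable (hX 0)
  have h := strong_law_Lp le_rfl ENNReal.one_ne_top X (memLp_one_iff_integrable.2 hint0)
    (fun i j hij => hind.indepFun hij)
    (fun i => ⟨(hX i).aemeasurable, (hX 0).aemeasurable, by rw [hlaw, hlaw]⟩)
  have h' := (ENNReal.tendsto_toReal ENNReal.zero_ne_top).comp h
  rw [← hlaw 0, integral_map (hX 0).aemeasurable (by fun_prop)]
  refine h'.congr fun n => ?_
  rw [Function.comp_apply, eLpNorm_one_eq_lintegral_enorm, ← integral_norm_eq_lintegral_enorm]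
  · rfl
  · have := hX
    fun_prop

end Average

section Transition

variable {G A : Measure ℝ} [IsProbabilityMeasure G] [IsProbabilityMeasure A]

instance (μ : Measure ℝ) [IsProbabilityMeasure μ] : IsProbabilityMeasure (delayStep G A μ) :=
  Measure.isProbabilityMeasure_map (by fun_prop)

instance isProbabilityMeasure_iterate_delayStep (μ : Measure ℝ) [IsProbabilityMeasure μ] (n : ℕ) :
    IsProbabilityMeasure ((delayStep G A)^[n] μ) := by
  induction n with
  | zero => assumption
  | succ n ih => rw [Function.iterate_succ_apply']; infer_instance

/-- `δ` is the weak limit of the laws of the delays in an initially empty queue. -/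
def IsEmptyStartLimit (G A δ : Measure ℝ) : Prop :=
  ∀ F : BoundedContinuousFunction ℝ ℝ,
    Tendsto (fun n => ∫ d, F d ∂((delayStep G A)^[n] (Measure.dirac 0))) atTop (𝓝 (∫ d, F d ∂δ))

/-- The transition operator of the delay chain maps bounded continuous functions to bounded
continuous functions. -/
theorem exists_integral_delayStep (F : BoundedContinuousFunction ℝ ℝ) :
    ∃ H : BoundedContinuousFunction ℝ ℝ, ∀ (μ : Measure ℝ) [IsProbabilityMeasure μ],
      ∫ d, F d ∂(delayStep G A μ) = ∫ d, H d ∂μ := by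
  have hm : ∀ d : ℝ, AEStronglyMeasurable (fun p : ℝ × ℝ => F (max (d + p.1 - p.2) 0))
      (G.prod A) := fun d =>
    (F.continuous.comp (by fun_prop)).aestronglyMeasurable
  have hc : Continuous fun d : ℝ => ∫ p : ℝ × ℝ, F (max (d + p.1 - p.2) 0) ∂(G.prod A) := by
    refine continuous_of_dominated hm (fun d => ae_of_all _ fun p => F.norm_coe_le_norm _)
      (integrable_const ‖F‖) (ae_of_all _ fun p => ?_)
    exact F.continuous.comp (by fun_prop)
  refine ⟨BoundedContinuousFunction.ofNormedAddCommGroup _ hc ‖F‖ fun d => ?_, fun μ _ => ?_⟩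
  · simpa using norm_integral_le_of_norm_le_const (μ := G.prod A)
      (ae_of_all _ fun p : ℝ × ℝ => F.norm_coe_le_norm (max (d + p.1 - p.2) 0))
  · rw [delayStep, integral_map (by fun_prop) F.continuous.aestronglyMeasurable,
      ← (measurePreserving_prodAssoc μ G A).symm.integral_comp', integral_prod]
    · rfl
    · exact Integrable.of_bound
        (F.continuous.comp (f := fun p : ℝ × (ℝ × ℝ) => max (p.1 + p.2.1 - p.2.2) 0)
          (by fun_prop)).aestronglyMeasurable ‖F‖
        (ae_of_all _ fun p => F.norm_coe_le_norm _)

/-- The limit law is stationary, because the transition operator is continuous for weak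
convergence. -/
theorem IsEmptyStartLimit.isStationaryDelayLaw {δ : ProbabilityMeasure ℝ}
    (hδ : IsEmptyStartLimit G A δ) : IsStationaryDelayLaw G A δ := by
  change delayStep G A δ = δ
  refine ext_of_forall_integral_eq_of_IsFiniteMeasure fun F => ?_
  obtain ⟨H, hH⟩ := exists_integral_delayStep (G := G) (A := A) F
  rw [hH]
  refine tendsto_nhds_unique (hδ H) (((tendsto_add_atTop_iff_nat 1).2 (hδ F)).congr fun n => ?_)
  rw [Function.iterate_succ_apply', hH]

end Transition

theorem IsInput.ae_tendsto_sum_atBot {Ω : Type*} [MeasurableSpace Ω] {P : Measure Ω}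
    {G A : Measure ℝ} {D₀ : Ω → ℝ} {S T : ℕ → Ω → ℝ} (hQ : IsInput P G A D₀ S T)
    (hG_int : Integrable (fun s => s) G) (hA_int : Integrable (fun t => t) A)
    (hdrift : ∫ s, s ∂G < ∫ t, t ∂A) :
    ∀ᵐ ω ∂P, Tendsto (fun n : ℕ => ∑ i ∈ Finset.range n, (S i ω - T i ω)) atTop atBot := by
  filter_upwards [ae_tendsto_average hQ.measurable_service hQ.law_service hQ.indep_service hG_int,
    ae_tendsto_average hQ.measurable_interarrival hQ.law_interarrival hQ.indep_interarrival
      hA_int] with ω hS hT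
  have h := (hS.sub hT).neg_mul_atTop (sub_neg.2 hdrift) tendsto_natCast_atTop_atTop
  refine h.congr' ?_
  filter_upwards [eventually_gt_atTop 0] with n hn
  have : (n : ℝ) ≠ 0 := by positivity
  rw [Finset.sum_sub_distrib]
  field_simp

section Stationary

variable {Ω : Type*} [MeasurableSpace Ω] {P : Measure Ω} [IsProbabilityMeasure P]
  {G A : Measure ℝ} {D₀ : Ω → ℝ} {S T : ℕ → Ω → ℝ}

theorem IsInput.map_delay (hQ : IsInput P G A D₀ S T) (n : ℕ) :
    P.map (delay D₀ S T n) = (delayStep G A)^[n] (P.map D₀) := by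
  induction n with
  | zero => rfl
  | succ n ih => rw [Function.iterate_succ_apply', ← ih, hQ.map_delay_succ]

/-- The backward delays increase and stay below the maximum of a random walk with negative drift,
so they converge almost surely, and their laws are those of the delays for an empty start. -/
theorem IsInput.exists_isEmptyStartLimit (hQ : IsInput P G A D₀ S T)
    (hG_int : Integrable (fun s => s) G) (hA_int : Integrable (fun t => t) A)
    (hdrift : ∫ s, s ∂G < ∫ t, t ∂A) :
    ∃ δ : ProbabilityMeasure ℝ, IsEmptyStartLimit G A δ := by
  have hconv : ∀ᵐ ω ∂P, ∃ l, Tendsto (fun n => backwardDelay S T n 0 ω) atTop (𝓝 l) := by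
    filter_upwards [hQ.ae_tendsto_sum_atBot hG_int hA_int hdrift] with ω hω
    obtain ⟨C, hC⟩ := bddAbove_range_of_tendsto_atTop_atBot hω
    refine ⟨_, tendsto_atTop_ciSup (monotone_backwardDelay 0 ω) ⟨C, ?_⟩⟩
    rintro _ ⟨n, rfl⟩
    simpa using backwardDelay_le (fun n => hC ⟨n, rfl⟩) n 0
  obtain ⟨M, hM, hlim⟩ := measurable_limit_of_tendsto_metrizable_ae
    (fun n => (hQ.measurable_backwardDelay n 0).aemeasurable) hconv
  refine ⟨⟨P.map M, Measure.isProbabilityMeasure_map hM.aemeasurable⟩, fun F => ?_⟩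
  have h := (tendstoInDistribution_of_ae_tendsto
    (fun n => (hQ.measurable_backwardDelay n 0).aemeasurable) hM.aemeasurable hlim).tendsto
  refine (ProbabilityMeasure.tendsto_iff_forall_integral_tendsto.1 h F).congr fun n => ?_
  have hlaw := hQ.map_backwardDelay n 0
  rw [hQ.zero_init.map_delay, Measure.map_const] at hlaw
  simp only [measure_univ, one_smul] at hlaw
  simp only [ProbabilityMeasure.coe_mk, hlaw]

/-- The delays converge in law to the same limit for every initial delay, because the random walk
with steps `S i - T i` drifts to `-∞`, so that the initial delay is eventually forgotten. -/
theorem IsInput.tendsto_integral_delay (hQ : IsInput P G A D₀ S T)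
    (hG_int : Integrable (fun s => s) G) (hA_int : Integrable (fun t => t) A)
    (hdrift : ∫ s, s ∂G < ∫ t, t ∂A) {δ : Measure ℝ} (hδ : IsEmptyStartLimit G A δ)
    (F : BoundedContinuousFunction ℝ ℝ) :
    Tendsto (fun n => ∫ ω, F (delay D₀ S T n ω) ∂P) atTop (𝓝 (∫ d, F d ∂δ)) := by
  have hzero : Tendsto (fun n => ∫ ω, F (delay (fun _ => 0) S T n ω) ∂P) atTop
      (𝓝 (∫ d, F d ∂δ)) := by
    refine (hδ F).congr fun n => ?_
    have hlaw := hQ.zero_init.map_delay n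
    rw [Measure.map_const] at hlaw
    simp only [measure_univ, one_smul] at hlaw
    rw [← hlaw, integral_map (hQ.zero_init.measurable_delay n).aemeasurable
      F.continuous.aestronglyMeasurable]
  have hm : ∀ n, AEStronglyMeasurable (fun ω => F (delay D₀ S T n ω)) P := fun n =>
    (F.continuous.measurable.comp (hQ.measurable_delay n)).aestronglyMeasurable
  have hm0 : ∀ n, AEStronglyMeasurable (fun ω => F (delay (fun _ => 0) S T n ω)) P := fun n =>
    (F.continuous.measurable.comp (hQ.zero_init.measurable_delay n)).aestronglyMeasurable
  have hi : ∀ n, Integrable (fun ω => F (delay D₀ S T n ω)) P := fun n =>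
    Integrable.of_bound (hm n) ‖F‖ (ae_of_all _ fun ω => F.norm_coe_le_norm _)
  have hi0 : ∀ n, Integrable (fun ω => F (delay (fun _ => 0) S T n ω)) P := fun n =>
    Integrable.of_bound (hm0 n) ‖F‖ (ae_of_all _ fun ω => F.norm_coe_le_norm _)
  have hdiff : Tendsto (fun n => ∫ ω, (F (delay D₀ S T n ω) - F (delay (fun _ => 0) S T n ω)) ∂P)
      atTop (𝓝 (∫ _, (0 : ℝ) ∂P)) := by
    refine tendsto_integral_of_dominated_convergence (fun _ => ‖F‖ + ‖F‖)
      (fun n => (hm n).sub (hm0 n)) (integrable_const _) (fun n => ae_of_all _ fun ω => ?_) ?_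
    · exact (norm_sub_le _ _).trans (add_le_add (F.norm_coe_le_norm _) (F.norm_coe_le_norm _))
    · filter_upwards [hQ.ae_tendsto_sum_atBot hG_int hA_int hdrift, hQ.init_nonneg] with ω hω h₀
      refine tendsto_const_nhds.congr' ?_
      -- the initial delay plays no role once the walk is below `-D₀`
      filter_upwards [hω.eventually_le_atBot (-D₀ ω)] with n hn
      rw [delay_eq_max h₀, max_eq_right, sub_self]
      exact (by linarith : D₀ ω + ∑ i ∈ Finset.range n, (S i ω - T i ω) ≤ 0).trans
        (delay_nonneg (D₀ := fun _ => 0) le_rfl n)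
  have h := hdiff.add hzero
  rw [integral_zero, zero_add] at h
  refine h.congr fun n => ?_
  rw [integral_sub (hi n) (hi0 n), sub_add_cancel]

theorem IsInput.tendstoInDistribution_delay (hQ : IsInput P G A D₀ S T)
    (hG_int : Integrable (fun s => s) G) (hA_int : Integrable (fun t => t) A)
    (hdrift : ∫ s, s ∂G < ∫ t, t ∂A) {δ : ProbabilityMeasure ℝ}
    (hδ : IsEmptyStartLimit G A δ) :
    TendstoInDistribution (delay D₀ S T) atTop (fun d : ℝ => d) (fun _ => P) (δ : Measure ℝ) where
  forall_aemeasurable n := (hQ.measurable_delay n).aemeasurable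
  aemeasurable_limit := measurable_id.aemeasurable
  tendsto := by
    refine ProbabilityMeasure.tendsto_iff_forall_integral_tendsto.2 fun F => ?_
    simp only [ProbabilityMeasure.coe_mk, Measure.map_id']
    refine (hQ.tendsto_integral_delay hG_int hA_int hdrift hδ F).congr fun n => ?_
    rw [integral_map (hQ.measurable_delay n).aemeasurable F.continuous.aestronglyMeasurable]

/-- The queue may be realized, on a product space, with any law on `[0, ∞)` of the initial
delay. -/
theorem IsInput.prod_init (hQ : IsInput P G A D₀ S T) (μ : Measure ℝ) [IsProbabilityMeasure μ]
    (hμ : ∀ᵐ d ∂μ, 0 ≤ d) :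
    IsInput (μ.prod P) G A (fun p => p.1) (fun n p => S n p.2) (fun n p => T n p.2) := by
  have hsnd : ∀ {β : Type} [MeasurableSpace β] (f : Ω → β), Measurable f →
      (μ.prod P).map (fun p => f p.2) = P.map f := fun f hf => by
    rw [← Function.comp_def, ← Measure.map_map hf measurable_snd, Measure.map_snd_prod,
      measure_univ, one_smul]
  have hmS := hQ.measurable_service
  have hmT := hQ.measurable_interarrival
  refine ⟨measurable_fst, fun n => (hmS n).comp measurable_snd,
    fun n => (hmT n).comp measurable_snd, Measure.quasiMeasurePreserving_fst.ae hμ,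
    fun n => (hsnd _ (hmS n)).trans (hQ.law_service n),
    fun n => (hsnd _ (hmT n)).trans (hQ.law_interarrival n), ?_, ?_, ?_, ?_⟩
  · refine (iIndepFun_iff_map_fun_eq_infinitePi_map
      fun n => (hmS n).comp measurable_snd).2 ?_
    refine ((hsnd (fun ω n => S n ω) (by fun_prop)).trans
      ((iIndepFun_iff_map_fun_eq_infinitePi_map hmS).1 hQ.indep_service)).trans ?_
    congr 1
    funext n
    exact (hsnd _ (hmS n)).symm
  · refine (iIndepFun_iff_map_fun_eq_infinitePi_map
      fun n => (hmT n).comp measurable_snd).2 ?_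
    refine ((hsnd (fun ω n => T n ω) (by fun_prop)).trans
      ((iIndepFun_iff_map_fun_eq_infinitePi_map hmT).1 hQ.indep_interarrival)).trans ?_
    congr 1
    funext n
    exact (hsnd _ (hmT n)).symm
  · rw [indepFun_iff_map_prod_eq_prod_map_map (by fun_prop) (by fun_prop),
      hsnd (fun ω => ((fun n => S n ω), (fun n => T n ω))) (by fun_prop),
      hsnd (fun ω n => S n ω) (by fun_prop), hsnd (fun ω n => T n ω) (by fun_prop)]
    exact (indepFun_iff_map_prod_eq_prod_map_map (by fun_prop) (by fun_prop)).1
      hQ.indep_service_interarrival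
  · exact indepFun_prod (X := fun d : ℝ => d)
      (Y := fun ω => ((fun n => S n ω), (fun n => T n ω))) measurable_id (by fun_prop)

theorem IsStationaryDelayLaw.ae_nonneg {G A : Measure ℝ} {δ : ProbabilityMeasure ℝ}
    (hδ : IsStationaryDelayLaw G A δ) : ∀ᵐ d ∂(δ : Measure ℝ), 0 ≤ d := by
  rw [← hδ, ae_map_iff (by fun_prop) measurableSet_Ici]
  exact ae_of_all _ fun p => le_max_right _ _

/-- A queue that starts with a stationary delay keeps that law, while its delays converge in law to
the limit for an empty start; hence there is no other stationary law. -/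
theorem IsInput.eq_of_isStationaryDelayLaw (hQ : IsInput P G A D₀ S T)
    (hG_int : Integrable (fun s => s) G) (hA_int : Integrable (fun t => t) A)
    (hdrift : ∫ s, s ∂G < ∫ t, t ∂A) {δ δ' : ProbabilityMeasure ℝ}
    (hδ : IsEmptyStartLimit G A δ) (hδ' : IsStationaryDelayLaw G A δ') : δ' = δ := by
  have hstep : delayStep G A δ' = δ' := hδ'
  have hQ' := hQ.prod_init (δ' : Measure ℝ) hδ'.ae_nonneg
  suffices h : (δ' : Measure ℝ) = δ from Subtype.ext h
  refine ext_of_forall_integral_eq_of_IsFiniteMeasure fun F => ?_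
  refine tendsto_nhds_unique (tendsto_const_nhds.congr fun n => ?_)
    (hQ'.tendsto_integral_delay hG_int hA_int hdrift hδ F)
  have hlaw := hQ'.map_delay n
  rw [Measure.map_fst_prod, measure_univ, one_smul, Function.iterate_fixed hstep] at hlaw
  rw [← integral_map (hQ'.measurable_delay n).aemeasurable F.continuous.aestronglyMeasurable,
    hlaw]

end Stationary

/-! ### The equilibrium distribution -/

theorem lintegral_max_sub_zero {G : Measure ℝ} (c : ℝ) :
    ∫⁻ s, ENNReal.ofReal (max (s - c) 0) ∂G = ∫⁻ y in Set.Ioi c, G (Set.Ioi y) := by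
  rw [lintegral_eq_lintegral_meas_lt G (f := fun s => max (s - c) 0)
      (ae_of_all _ fun s => le_max_right _ _) (by fun_prop),
    ← (measurePreserving_add_left volume c).setLIntegral_comp_preimage_emb
      (measurableEmbedding_addLeft c) (fun y => G (Set.Ioi y)) (Set.Ioi c)]
  have hpre : (fun y => c + y) ⁻¹' Set.Ioi c = Set.Ioi 0 := by ext y; simp
  rw [hpre]
  refine setLIntegral_congr_fun measurableSet_Ioi fun y (hy : 0 < y) => ?_
  congr 1
  ext s
  simp only [Set.mem_ofPred_eq, Set.mem_Ioi, lt_max_iff, hy.not_gt, or_false, lt_sub_iff_add_lt']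

section Equilibrium

variable {G : Measure ℝ} [IsProbabilityMeasure G]

theorem integrable_max_sub_zero (hG_int : Integrable (fun s => s) G) (c : ℝ) :
    Integrable (fun s => max (s - c) 0) G :=
  (hG_int.sub (integrable_const c)).pos_part

/-- The tail of `G_e` at `z` is `E(S - z⁺)⁺ / E(S)`. -/
theorem equilibrium_Ioi (hG_int : Integrable (fun s => s) G) (hG_pos : 0 < ∫ s, s ∂G) (z : ℝ) :
    equilibrium G (Set.Ioi z)
      = ENNReal.ofReal ((∫ s, s ∂G)⁻¹ * ∫ s, max (s - max z 0) 0 ∂G) := by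
  have hm : Measurable fun y => G (Set.Ioi y) :=
    Antitone.measurable fun y z hyz => measure_mono (Set.Ioi_subset_Ioi hyz)
  have hset : (Set.Ioi z ∩ Set.Ici 0 : Set ℝ) =ᵐ[volume] Set.Ioi (max z 0) := by
    rw [← Set.Ioi_inter_Ioi]
    exact ae_eq_set_inter (ae_eq_refl _) Ioi_ae_eq_Ici.symm
  rw [equilibrium, withDensity_apply _ measurableSet_Ioi, Measure.restrict_restrict
    measurableSet_Ioi, setLIntegral_congr hset, ENNReal.ofReal_mul (inv_nonneg.2 hG_pos.le),
    ofReal_integral_eq_lintegral_ofReal (integrable_max_sub_zero hG_int _)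
      (ae_of_all _ fun s => le_max_right _ _), lintegral_max_sub_zero, ← lintegral_const_mul _ hm]
  refine lintegral_congr fun y => ?_
  rw [ENNReal.ofReal_mul (inv_nonneg.2 hG_pos.le), ofReal_measureReal]

theorem isProbabilityMeasure_equilibrium (hG_nonneg : G (Set.Iio 0) = 0)
    (hG_int : Integrable (fun s => s) G) (hG_pos : 0 < ∫ s, s ∂G) :
    IsProbabilityMeasure (equilibrium G) := by
  have hnn : ∀ᵐ s ∂G, 0 ≤ s := by
    rw [ae_iff]
    simpa [Set.Iio] using hG_nonneg
  have h1 : equilibrium G (Set.Ioi (-1)) = 1 := by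
    have h : ∫ s, max (s - max (-1) 0) 0 ∂G = ∫ s, s ∂G := by
      refine integral_congr_ae (hnn.mono fun s hs => ?_)
      simp [hs]
    rw [equilibrium_Ioi hG_int hG_pos, h, inv_mul_cancel₀ hG_pos.ne', ENNReal.ofReal_one]
  have h2 : equilibrium G (Set.Iic (-1)) = 0 := by
    rw [equilibrium, withDensity_apply _ measurableSet_Iic,
      Measure.restrict_restrict measurableSet_Iic]
    have : (Set.Iic (-1) ∩ Set.Ici 0 : Set ℝ) = ∅ := by
      ext y
      simp only [Set.mem_inter_iff, Set.mem_Iic, Set.mem_Ici, Set.mem_empty_iff_false, iff_false]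
      rintro ⟨h, h'⟩
      linarith
    simp [this]
  refine ⟨?_⟩
  rw [← Set.Ioi_union_Iic (a := (-1 : ℝ)),
    measure_union (Set.Iic_disjoint_Ioi le_rfl).symm measurableSet_Iic, h1, h2, add_zero]

/-- With `a(v) = (v - x)⁺`, the tail of `D + S_e` is the mean increment of `a` at a jump of size
`S` from level `D`. -/
theorem integral_mul_prod_equilibrium_real (hG_nonneg : G (Set.Iio 0) = 0)
    (hG_int : Integrable (fun s => s) G) (hG_pos : 0 < ∫ s, s ∂G)
    (δ : Measure ℝ) [IsProbabilityMeasure δ] (x : ℝ) :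
    (∫ s, s ∂G) * (δ.prod (equilibrium G)).real {p : ℝ × ℝ | x < p.1 + p.2}
      = ∫ d, ∫ s, (max (d + s - x) 0 - max (d - x) 0) ∂G ∂δ := by
  have := isProbabilityMeasure_equilibrium hG_nonneg hG_int hG_pos
  have hnn : ∀ᵐ s ∂G, 0 ≤ s := by
    rw [ae_iff]
    simpa [Set.Iio] using hG_nonneg
  have hset : MeasurableSet {p : ℝ × ℝ | x < p.1 + p.2} :=
    measurableSet_lt measurable_const (by fun_prop)
  rw [measureReal_def, Measure.prod_apply hset, ← integral_toReal
    (measurable_measure_prodMk_left hset).aemeasurable (ae_of_all _ fun d => measure_lt_top _ _),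
    ← integral_const_mul]
  refine integral_congr_ae (ae_of_all _ fun d => ?_)
  have hpre : Prod.mk d ⁻¹' {p : ℝ × ℝ | x < p.1 + p.2} = Set.Ioi (x - d) := by
    ext y
    simp [sub_lt_iff_lt_add']
  have hint : 0 ≤ ∫ s, max (s - max (x - d) 0) 0 ∂G :=
    integral_nonneg fun s => le_max_right _ _
  simp only [hpre]
  rw [equilibrium_Ioi hG_int hG_pos, ENNReal.toReal_ofReal (by positivity), ← mul_assoc,
    mul_inv_cancel₀ hG_pos.ne', one_mul]
  refine integral_congr_ae (hnn.mono fun s hs => ?_)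
  simp only
  rcases le_total x d with h | h
  · rw [max_eq_right (by linarith : x - d ≤ 0), max_eq_left (by linarith : (0 : ℝ) ≤ s - 0),
      max_eq_left (by linarith : 0 ≤ d + s - x), max_eq_left (by linarith : 0 ≤ d - x)]
    ring
  · rw [max_eq_left (by linarith : 0 ≤ x - d), max_eq_right (by linarith : d - x ≤ 0), sub_zero]
    congr 1
    ring

end Equilibrium

/-! ### Measurability of the workload -/

section Measurability

variable {Ω : Type*} [MeasurableSpace Ω] {D₀ : Ω → ℝ} {S T : ℕ → Ω → ℝ}

theorem measurable_arrivalTime (hT : ∀ n, Measurable (T n)) (n : ℕ) :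
    Measurable (arrivalTime T n) :=
  Finset.measurable_fun_sum _ fun i _ => hT i

/-- The index of the last arrival is jointly measurable in time and the sample point, without any
assumption on the signs of the interarrival times. -/
theorem measurable_lastArrival (hT : ∀ n, Measurable (T n)) :
    Measurable fun p : ℝ × Ω => lastArrival T p.1 p.2 := by
  have hpos : ∀ n ≠ 0, MeasurableSet ((fun p : ℝ × Ω => lastArrival T p.1 p.2) ⁻¹' {n}) := by
    intro n hn
    have hset : (fun p : ℝ × Ω => lastArrival T p.1 p.2) ⁻¹' {n}
        = {p | arrivalTime T n p.2 ≤ p.1} ∩ ⋂ k > n, {p | arrivalTime T k p.2 ≤ p.1}ᶜ := by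
      ext p
      simp only [Set.mem_preimage, Set.mem_singleton_iff, Set.mem_inter_iff, Set.mem_ofPred_eq,
        Set.mem_iInter, Set.mem_compl_iff]
      constructor
      · intro h
        have hne : {k : ℕ | arrivalTime T k p.2 ≤ p.1}.Nonempty := by
          by_contra hempty
          rw [lastArrival, Set.not_nonempty_iff_eq_empty.1 hempty] at h
          exact hn (by simpa using h.symm)
        have hbdd : BddAbove {k : ℕ | arrivalTime T k p.2 ≤ p.1} := by
          -- the supremum of an unbounded set of natural numbers is `0`
          by_contra hunb
          rw [lastArrival, Nat.sSup_of_not_bddAbove hunb] at h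
          exact hn h.symm
        refine ⟨h ▸ Nat.sSup_mem hne hbdd, fun k hk hmem => ?_⟩
        exact absurd (le_csSup hbdd hmem) (not_le.2 (by rw [← h] at hk; exact hk))
      · rintro ⟨h₁, h₂⟩
        exact IsGreatest.csSup_eq ⟨h₁, fun k hk => not_lt.1 fun hlt => h₂ k hlt hk⟩
    rw [hset]
    have hle : ∀ k, MeasurableSet {p : ℝ × Ω | arrivalTime T k p.2 ≤ p.1} := fun k =>
      measurableSet_le ((measurable_arrivalTime hT k).comp measurable_snd) measurable_fst
    exact (hle n).inter (MeasurableSet.iInter fun k => MeasurableSet.iInter fun _ => (hle k).compl)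
  refine measurable_to_countable' fun n => ?_
  rcases eq_or_ne n 0 with rfl | hn
  · have hset : (fun p : ℝ × Ω => lastArrival T p.1 p.2) ⁻¹' {0}
        = (⋃ n ≠ 0, (fun p : ℝ × Ω => lastArrival T p.1 p.2) ⁻¹' {n})ᶜ := by
      ext p
      simp only [Set.mem_preimage, Set.mem_singleton_iff, Set.mem_compl_iff, Set.mem_iUnion,
        not_exists]
      exact ⟨fun h n hn hp => hn (hp.symm.trans h), fun h => by_contra fun h0 => h _ h0 rfl⟩
    rw [hset]
    exact (MeasurableSet.iUnion fun n => MeasurableSet.iUnion fun hn => hpos n hn).compl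
  · exact hpos n hn

theorem measurable_workload (hD : ∀ n, Measurable (delay D₀ S T n)) (hS : ∀ n, Measurable (S n))
    (hT : ∀ n, Measurable (T n)) :
    Measurable fun p : ℝ × Ω => workload D₀ S T p.1 p.2 := by
  have hF : Measurable fun q : ℕ × (ℝ × Ω) =>
      max (delay D₀ S T q.1 q.2.2 + S q.1 q.2.2 - (q.2.1 - arrivalTime T q.1 q.2.2)) 0 := by
    refine measurable_from_prod_countable_right fun n => ?_
    have h1 : Measurable fun q : ℝ × Ω => delay D₀ S T n q.2 := (hD n).comp measurable_snd
    have h2 : Measurable fun q : ℝ × Ω => S n q.2 := (hS n).comp measurable_snd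
    have h3 : Measurable fun q : ℝ × Ω => arrivalTime T n q.2 :=
      (measurable_arrivalTime hT n).comp measurable_snd
    exact ((h1.add h2).sub (measurable_fst.sub h3)).max measurable_const
  exact hF.comp ((measurable_lastArrival hT).prodMk measurable_id)

end Measurability

/-! ### Time above a level along a path -/

section TimeAbove

variable {Ω : Type*} {D₀ : Ω → ℝ} {S T : ℕ → Ω → ℝ}

/-- The time that the workload spends above the level `x` during `[0, t]`. -/
noncomputable def timeAbove (D₀ : Ω → ℝ) (S T : ℕ → Ω → ℝ) (x t : ℝ) (ω : Ω) : ℝ :=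
  ∫ s in (0 : ℝ)..t, {s : ℝ | x < workload D₀ S T s ω}.indicator (fun _ => (1 : ℝ)) s

/-- Between two arrivals the workload decreases at unit rate until it reaches `0`, so the time that
it spends above `x` is the decrease of `(V - x)⁺`. -/
theorem integral_indicator_workload {x : ℝ} (hx : 0 ≤ x) {ω : Ω} (hT : ∀ k, 0 ≤ T k ω) (n : ℕ) :
    ∫ s in arrivalTime T n ω..arrivalTime T (n + 1) ω,
        {s : ℝ | x < workload D₀ S T s ω}.indicator (fun _ => (1 : ℝ)) s
      = max (delay D₀ S T n ω + S n ω - x) 0 - max (delay D₀ S T (n + 1) ω - x) 0 := by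
  have hsucc : arrivalTime T (n + 1) ω = arrivalTime T n ω + T n ω := by
    simp [arrivalTime, Finset.sum_range_succ]
  have hle : arrivalTime T n ω ≤ arrivalTime T (n + 1) ω := by linarith [hT n]
  have hind : ∀ s ∈ Set.Ioo (arrivalTime T n ω) (arrivalTime T (n + 1) ω),
      {s : ℝ | x < workload D₀ S T s ω}.indicator (fun _ => (1 : ℝ)) s
        = (Set.Iio (arrivalTime T n ω + (delay D₀ S T n ω + S n ω - x))).indicator
          (fun _ => (1 : ℝ)) s := by
    intro s hs
    refine Set.indicator_eq_indicator ?_ rfl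
    rw [Set.mem_ofPred_eq, workload_eq D₀ S T s ω n hT hs.1.le hs.2, lt_max_iff, Set.mem_Iio]
    constructor
    · rintro (h | h) <;> linarith
    · intro h
      left
      linarith
  rw [intervalIntegral.integral_of_le hle, integral_Ioc_eq_integral_Ioo,
    setIntegral_congr_fun measurableSet_Ioo hind, setIntegral_indicator measurableSet_Iio,
    Set.Ioo_inter_Iio, setIntegral_const, Real.volume_real_Ioo, smul_eq_mul, mul_one, hsucc, delay]
  have hTn := hT n
  generalize delay D₀ S T n ω + S n ω = z
  rcases le_total (z - T n ω) 0 with h₁ | h₁ <;> rcases le_total (z - x) (T n ω) with h₂ | h₂ <;>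
    rcases le_total (z - x) 0 with h₃ | h₃ <;> grind

theorem intervalIntegrable_indicator_workload {x : ℝ} {ω : Ω}
    (hm : Measurable fun s => workload D₀ S T s ω) (a b : ℝ) :
    IntervalIntegrable ({s : ℝ | x < workload D₀ S T s ω}.indicator (fun _ => (1 : ℝ)))
      volume a b := by
  rw [intervalIntegrable_iff]
  exact IntegrableOn.indicator (integrableOn_const (by simp)) (measurableSet_lt measurable_const hm)

theorem timeAbove_arrivalTime {x : ℝ} (hx : 0 ≤ x) {ω : Ω} (hT : ∀ k, 0 ≤ T k ω)
    (hm : Measurable fun s => workload D₀ S T s ω) (m : ℕ) :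
    timeAbove D₀ S T x (arrivalTime T m ω) ω
      = ∑ n ∈ Finset.range m,
        (max (delay D₀ S T n ω + S n ω - x) 0 - max (delay D₀ S T (n + 1) ω - x) 0) := by
  have h := intervalIntegral.sum_integral_adjacent_intervals (μ := volume)
    (f := {s : ℝ | x < workload D₀ S T s ω}.indicator (fun _ => (1 : ℝ)))
    (a := fun k => arrivalTime T k ω) (n := m)
    fun k _ => intervalIntegrable_indicator_workload hm _ _
  rw [timeAbove, ← Finset.sum_congr rfl fun n _ => integral_indicator_workload hx hT n, h]
  simp [arrivalTime]

theorem abs_timeAbove_sub_le {x : ℝ} {ω : Ω} (hm : Measurable fun s => workload D₀ S T s ω)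
    (t u : ℝ) : |timeAbove D₀ S T x t ω - timeAbove D₀ S T x u ω| ≤ |t - u| := by
  rw [timeAbove, timeAbove, intervalIntegral.integral_interval_sub_left
    (intervalIntegrable_indicator_workload hm _ _) (intervalIntegrable_indicator_workload hm _ _)]
  have h := intervalIntegral.norm_integral_le_of_norm_le_const (a := u) (b := t) (C := 1)
    (f := {s : ℝ | x < workload D₀ S T s ω}.indicator (fun _ => (1 : ℝ))) fun s _ => by
      by_cases hs : s ∈ {s : ℝ | x < workload D₀ S T s ω} <;> simp [hs]
  simpa using h

theorem timeAbove_le {x : ℝ} (hx : 0 ≤ x) {ω : Ω} (hT : ∀ k, 0 ≤ T k ω)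
    (hm : Measurable fun s => workload D₀ S T s ω) (m : ℕ) (t : ℝ) :
    timeAbove D₀ S T x t ω
      ≤ ∑ n ∈ Finset.range m, (max (delay D₀ S T n ω + S n ω - x) 0 - max (delay D₀ S T n ω - x) 0)
        + max (D₀ ω - x) 0 + |t - arrivalTime T m ω| := by
  have h₁ := (abs_le.1 (abs_timeAbove_sub_le (x := x) hm t (arrivalTime T m ω))).2
  have h₂ := Finset.sum_range_sub (fun n => max (delay D₀ S T n ω - x) 0) m
  rw [timeAbove_arrivalTime hx hT hm] at h₁
  have h₃ : max (delay D₀ S T 0 ω - x) 0 = max (D₀ ω - x) 0 := rfl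
  have h₄ := le_max_right (delay D₀ S T m ω - x) 0
  simp only [Finset.sum_sub_distrib] at h₁ h₂ ⊢
  linarith

/-- A lower bound for the time above `x`. The truncation at `K` keeps the contribution of the last
delay bounded. -/
theorem le_timeAbove {x K : ℝ} (hx : 0 ≤ x) (hK : 0 ≤ K) {ω : Ω} (hD : 0 ≤ D₀ ω)
    (hS : ∀ k, 0 ≤ S k ω) (hT : ∀ k, 0 ≤ T k ω)
    (hm : Measurable fun s => workload D₀ S T s ω) (m : ℕ) (t : ℝ) :
    ∑ n ∈ Finset.range m, (min (max (delay D₀ S T n ω + S n ω - x) 0) K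
        - min (max (delay D₀ S T n ω - x) 0) K) - K - |t - arrivalTime T m ω|
      ≤ timeAbove D₀ S T x t ω := by
  have h₁ := (abs_le.1 (abs_timeAbove_sub_le (x := x) hm t (arrivalTime T m ω))).1
  have h₂ := Finset.sum_range_sub (fun n => min (max (delay D₀ S T n ω - x) 0) K) m
  rw [timeAbove_arrivalTime hx hT hm] at h₁
  have h₃ : ∑ n ∈ Finset.range m, (min (max (delay D₀ S T n ω + S n ω - x) 0) K
        - min (max (delay D₀ S T (n + 1) ω - x) 0) K)
      ≤ ∑ n ∈ Finset.range m,
        (max (delay D₀ S T n ω + S n ω - x) 0 - max (delay D₀ S T (n + 1) ω - x) 0) := by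
    refine Finset.sum_le_sum fun n _ => ?_
    have hle : max (delay D₀ S T (n + 1) ω - x) 0 ≤ max (delay D₀ S T n ω + S n ω - x) 0 := by
      refine max_le_max (sub_le_sub_right ?_ x) le_rfl
      exact max_le (by linarith [hT n]) (add_nonneg (delay_nonneg hD n) (hS n))
    grind
  have h₄ : 0 ≤ min (max (delay D₀ S T 0 ω - x) 0) K := le_min (le_max_right _ _) hK
  have h₅ := min_le_right (max (delay D₀ S T m ω - x) 0) K
  simp only [Finset.sum_sub_distrib] at h₁ h₂ h₃ ⊢
  linarith

end TimeAbove

/-! ### The long-run fraction of time above a level -/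

theorem lipschitzWith_max_sub (x : ℝ) : LipschitzWith 1 fun v : ℝ => max (v - x) 0 := by
  refine LipschitzWith.max_const ?_ 0
  exact LipschitzWith.of_dist_le_mul fun a b => by simp

/-- The integer part of `t / E(T)`, the approximate number of arrivals by time `t`. Comparing `t`
with the arrival epoch of this deterministic index makes the counting process of arrivals
unnecessary. -/
noncomputable def meanArrivals (A : Measure ℝ) (t : ℝ) : ℕ := ⌊(∫ u, u ∂A)⁻¹ * t⌋₊

theorem tendsto_meanArrivals_div {A : Measure ℝ} (hA_pos : 0 < ∫ t, t ∂A) :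
    Tendsto (fun t : ℝ => (meanArrivals A t : ℝ) / t) atTop (𝓝 (∫ t, t ∂A)⁻¹) :=
  tendsto_nat_floor_mul_div_atTop (inv_nonneg.2 hA_pos.le)

theorem tendsto_meanArrivals {A : Measure ℝ} (hA_pos : 0 < ∫ t, t ∂A) :
    Tendsto (meanArrivals A) atTop atTop :=
  tendsto_nat_floor_atTop.comp (tendsto_id.const_mul_atTop (inv_pos.2 hA_pos))

theorem tendsto_average_meanArrivals {A : Measure ℝ} (hA_pos : 0 < ∫ t, t ∂A) {u : ℕ → ℝ} {l : ℝ}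
    (hu : Tendsto u atTop (𝓝 l)) :
    Tendsto (fun t : ℝ => t⁻¹ * ∑ n ∈ Finset.range (meanArrivals A t), u n) atTop
      (𝓝 ((∫ t, t ∂A)⁻¹ * l)) := by
  have h := (tendsto_meanArrivals_div hA_pos).mul (hu.cesaro.comp (tendsto_meanArrivals hA_pos))
  refine h.congr fun t => ?_
  simp only [Function.comp_apply]
  rcases eq_or_ne (meanArrivals A t) 0 with h0 | h0
  · simp [h0]
  · have : (meanArrivals A t : ℝ) ≠ 0 := by exact_mod_cast h0
    field_simp

section Workload

variable {Ω : Type*} [MeasurableSpace Ω] {P : Measure Ω} {G A : Measure ℝ} {D₀ : Ω → ℝ}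
  {S T : ℕ → Ω → ℝ}

theorem IsInput.measurable_workload (hQ : IsInput P G A D₀ S T) :
    Measurable fun p : ℝ × Ω => workload D₀ S T p.1 p.2 :=
  GIGI1.measurable_workload hQ.measurable_delay hQ.measurable_service hQ.measurable_interarrival

theorem IsInput.measurable_workload_path (hQ : IsInput P G A D₀ S T) (ω : Ω) :
    Measurable fun s => workload D₀ S T s ω :=
  Measurable.comp (g := fun p : ℝ × Ω => workload D₀ S T p.1 p.2) (f := fun s => (s, ω))
    hQ.measurable_workload measurable_prodMk_right

theorem IsInput.measurable_workload_time (hQ : IsInput P G A D₀ S T) (t : ℝ) :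
    Measurable (workload D₀ S T t) :=
  Measurable.comp (g := fun p : ℝ × Ω => workload D₀ S T p.1 p.2) (f := fun ω => (t, ω))
    hQ.measurable_workload measurable_prodMk_left

theorem IsInput.ae_service_nonneg (hQ : IsInput P G A D₀ S T) (hG_nonneg : G (Set.Iio 0) = 0) :
    ∀ᵐ ω ∂P, ∀ k, 0 ≤ S k ω := by
  refine ae_all_iff.2 fun k => ?_
  rw [← hQ.law_service k, Measure.map_apply (hQ.measurable_service k) measurableSet_Iio]
    at hG_nonneg
  filter_upwards [measure_eq_zero_iff_ae_notMem.1 hG_nonneg] with ω hω using not_lt.1 hω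

theorem IsInput.ae_interarrival_nonneg (hQ : IsInput P G A D₀ S T)
    (hA_nonneg : A (Set.Iio 0) = 0) : ∀ᵐ ω ∂P, ∀ k, 0 ≤ T k ω := by
  refine ae_all_iff.2 fun k => ?_
  rw [← hQ.law_interarrival k, Measure.map_apply (hQ.measurable_interarrival k) measurableSet_Iio]
    at hA_nonneg
  filter_upwards [measure_eq_zero_iff_ae_notMem.1 hA_nonneg] with ω hω using not_lt.1 hω

theorem IsInput.integrable_service (hQ : IsInput P G A D₀ S T)
    (hG_int : Integrable (fun s => s) G) (n : ℕ) : Integrable (S n) P := by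
  rw [← hQ.law_service n] at hG_int
  exact hG_int.comp_measurable (hQ.measurable_service n)

theorem IsInput.integrable_arrivalTime (hQ : IsInput P G A D₀ S T)
    (hA_int : Integrable (fun t => t) A) (n : ℕ) : Integrable (arrivalTime T n) P := by
  refine integrable_finsetSum _ fun i _ => ?_
  rw [← hQ.law_interarrival i] at hA_int
  exact hA_int.comp_measurable (hQ.measurable_interarrival i)

theorem IsInput.integrable_increment (hQ : IsInput P G A D₀ S T)
    (hG_int : Integrable (fun s => s) G) {φ : ℝ → ℝ} (hφ : LipschitzWith 1 φ) (n : ℕ) :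
    Integrable (fun ω => φ (delay D₀ S T n ω + S n ω) - φ (delay D₀ S T n ω)) P := by
  refine (hQ.integrable_service hG_int n).mono ?_ (ae_of_all _ fun ω => ?_)
  · have h1 := hQ.measurable_delay n
    have h2 := hQ.measurable_service n
    have h3 := hφ.continuous.measurable
    exact ((h3.comp (h1.add h2)).sub (h3.comp h1)).aestronglyMeasurable
  · simpa [dist_eq_norm] using hφ.dist_le_mul (delay D₀ S T n ω + S n ω) (delay D₀ S T n ω)

variable [IsProbabilityMeasure P]

/-- By the law of large numbers in mean, the arrival epoch with index `meanArrivals A t` differs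
from `t` by `o(t)` in mean. -/
theorem IsInput.tendsto_integral_abs_sub_arrivalTime (hQ : IsInput P G A D₀ S T)
    (hA_int : Integrable (fun t => t) A) (hA_pos : 0 < ∫ t, t ∂A) :
    Tendsto (fun t : ℝ => t⁻¹ * ∫ ω, |t - arrivalTime T (meanArrivals A t) ω| ∂P) atTop
      (𝓝 0) := by
  have hr := tendsto_meanArrivals_div hA_pos
  have hL := (tendsto_integral_abs_average_sub hQ.measurable_interarrival hQ.law_interarrival
    hQ.indep_interarrival hA_int).comp (tendsto_meanArrivals hA_pos)
  have hup : Tendsto (fun t : ℝ => |1 - (meanArrivals A t : ℝ) / t * ∫ u, u ∂A|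
      + (meanArrivals A t : ℝ) / t * ∫ ω, |((meanArrivals A t : ℕ) : ℝ)⁻¹
        * (∑ i ∈ Finset.range (meanArrivals A t), T i ω) - ∫ u, u ∂A| ∂P) atTop (𝓝 0) := by
    have h := ((hr.mul_const (∫ u, u ∂A)).const_sub 1).abs.add (hr.mul hL)
    rwa [inv_mul_cancel₀ hA_pos.ne', sub_self, abs_zero, mul_zero, add_zero] at h
  refine squeeze_zero' ?_ ?_ hup
  · filter_upwards [eventually_gt_atTop 0] with t ht
    exact mul_nonneg (inv_pos.2 ht).le (integral_nonneg fun ω => abs_nonneg _)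
  · filter_upwards [eventually_gt_atTop 0] with t ht
    set m := meanArrivals A t
    set τ := ∫ u, u ∂A
    have hint := hQ.integrable_arrivalTime hA_int m
    have hpt : ∀ ω, t⁻¹ * |t - arrivalTime T m ω| ≤ |1 - (m : ℝ) / t * τ|
        + (m : ℝ) / t * |(m : ℝ)⁻¹ * (∑ i ∈ Finset.range m, T i ω) - τ| := by
      intro ω
      have hmt : (0 : ℝ) ≤ (m : ℝ) / t := by positivity
      have heq : t⁻¹ * (t - arrivalTime T m ω) = (1 - (m : ℝ) / t * τ)
          - (m : ℝ) / t * ((m : ℝ)⁻¹ * (∑ i ∈ Finset.range m, T i ω) - τ) := by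
        rcases eq_or_ne m 0 with h0 | h0
        · simp [h0, arrivalTime, ht.ne']
        · have : (m : ℝ) ≠ 0 := by exact_mod_cast h0
          rw [arrivalTime]
          field_simp
          ring
      have habs := abs_mul t⁻¹ (t - arrivalTime T m ω)
      rw [abs_of_pos (inv_pos.2 ht)] at habs
      rw [← habs, heq]
      refine (abs_sub _ _).trans (add_le_add le_rfl ?_)
      rw [abs_mul, abs_of_nonneg hmt]
    have hint2 : Integrable (fun ω => |(m : ℝ)⁻¹ * (∑ i ∈ Finset.range m, T i ω) - τ|) P :=
      ((hint.const_mul _).sub (integrable_const _)).abs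
    calc t⁻¹ * ∫ ω, |t - arrivalTime T m ω| ∂P
        = ∫ ω, t⁻¹ * |t - arrivalTime T m ω| ∂P := (integral_const_mul _ _).symm
      _ ≤ ∫ ω, (|1 - (m : ℝ) / t * τ|
            + (m : ℝ) / t * |(m : ℝ)⁻¹ * (∑ i ∈ Finset.range m, T i ω) - τ|) ∂P :=
          integral_mono (((integrable_const _).sub hint).abs.const_mul _)
            ((integrable_const _).add (hint2.const_mul _)) hpt
      _ = _ := by
          rw [integral_add (integrable_const _) (hint2.const_mul _), integral_const_mul]
          simp

theorem IsInput.integrable_indicator_workload (hQ : IsInput P G A D₀ S T) (x t : ℝ) :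
    Integrable (fun p : ℝ × Ω => {s : ℝ | x < workload D₀ S T s p.2}.indicator
      (fun _ => (1 : ℝ)) p.1) ((volume.restrict (Set.Ioc 0 t)).prod P) := by
  have hset : MeasurableSet {p : ℝ × Ω | x < workload D₀ S T p.1 p.2} :=
    measurableSet_lt measurable_const hQ.measurable_workload
  exact (integrable_const (1 : ℝ)).indicator hset

theorem IsInput.integrable_timeAbove (hQ : IsInput P G A D₀ S T) (x : ℝ) {t : ℝ} (ht : 0 ≤ t) :
    Integrable (timeAbove D₀ S T x t) P := by
  have h := (hQ.integrable_indicator_workload x t).integral_prod_right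
  refine h.congr (ae_of_all _ fun ω => ?_)
  simp only [timeAbove]
  rw [intervalIntegral.integral_of_le ht]

theorem IsInput.integral_real_workload (hQ : IsInput P G A D₀ S T) (x : ℝ) {t : ℝ} (ht : 0 ≤ t) :
    ∫ s in (0 : ℝ)..t, P.real {ω | x < workload D₀ S T s ω} = ∫ ω, timeAbove D₀ S T x t ω ∂P := by
  simp only [timeAbove, intervalIntegral.integral_of_le ht]
  rw [← integral_integral_swap (hQ.integrable_indicator_workload x t)]
  refine integral_congr_ae (ae_of_all _ fun s => ?_)
  have hset : MeasurableSet {ω | x < workload D₀ S T s ω} :=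
    measurableSet_lt measurable_const (hQ.measurable_workload_time s)
  exact (integral_indicator_one hset).symm

theorem IsInput.tendsto_integral_min_init (hQ : IsInput P G A D₀ S T) (x : ℝ) :
    Tendsto (fun t : ℝ => ∫ ω, min 1 (t⁻¹ * max (D₀ ω - x) 0) ∂P) atTop (𝓝 0) := by
  have hm := hQ.measurable_init
  have h := tendsto_integral_filter_of_dominated_convergence (μ := P) (l := atTop)
    (F := fun (t : ℝ) ω => min 1 (t⁻¹ * max (D₀ ω - x) 0)) (f := fun _ => 0) (fun _ => (1 : ℝ))
    (Eventually.of_forall fun t => Measurable.aestronglyMeasurable (by fun_prop)) ?_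
    (integrable_const _) (ae_of_all _ fun ω => ?_)
  · simpa using h
  · filter_upwards [eventually_gt_atTop 0] with t ht
    refine ae_of_all _ fun ω => ?_
    rw [Real.norm_of_nonneg (by positivity)]
    exact min_le_left _ _
  · have := (tendsto_const_nhds (x := (1 : ℝ))).min
      ((tendsto_inv_atTop_zero (𝕜 := ℝ)).mul_const (max (D₀ ω - x) 0))
    simpa using this

/-- The mean fraction of time above `x` in `[0, t]` is at most an average of mean increments at
jumps, plus terms that vanish as `t → ∞`. The first error term absorbs the initial delay, which
need not be integrable. -/
theorem IsInput.average_real_workload_le (hQ : IsInput P G A D₀ S T)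
    (hG_nonneg : G (Set.Iio 0) = 0) (hA_nonneg : A (Set.Iio 0) = 0)
    (hG_int : Integrable (fun s => s) G) (hA_int : Integrable (fun t => t) A)
    {x : ℝ} (hx : 0 ≤ x) {t : ℝ} (ht : 0 < t) (m : ℕ) :
    t⁻¹ * ∫ ω, timeAbove D₀ S T x t ω ∂P
      ≤ t⁻¹ * ∑ n ∈ Finset.range m,
          ∫ ω, (max (delay D₀ S T n ω + S n ω - x) 0 - max (delay D₀ S T n ω - x) 0) ∂P
        + ∫ ω, min 1 (t⁻¹ * max (D₀ ω - x) 0) ∂P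
        + t⁻¹ * ∫ ω, |t - arrivalTime T m ω| ∂P := by
  have hinc := hQ.integrable_increment hG_int (lipschitzWith_max_sub x)
  have hsum : Integrable (fun ω => ∑ n ∈ Finset.range m,
      (max (delay D₀ S T n ω + S n ω - x) 0 - max (delay D₀ S T n ω - x) 0)) P :=
    integrable_finsetSum _ fun n _ => hinc n
  have habs : Integrable (fun ω => |t - arrivalTime T m ω|) P :=
    ((integrable_const t).sub (hQ.integrable_arrivalTime hA_int m)).abs
  have hmin : Integrable (fun ω => min 1 (t⁻¹ * max (D₀ ω - x) 0)) P := by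
    have hm := hQ.measurable_init
    refine Integrable.of_bound (Measurable.aestronglyMeasurable (by fun_prop)) 1
      (ae_of_all _ fun ω => ?_)
    rw [Real.norm_of_nonneg (by positivity)]
    exact min_le_left _ _
  have hsum' := hsum.const_mul t⁻¹
  have habs' := habs.const_mul t⁻¹
  have hadd := hsum'.add hmin
  rw [← integral_finsetSum _ fun n _ => hinc n, ← integral_const_mul, ← integral_const_mul,
    ← integral_const_mul, ← integral_add hsum' hmin]
  refine le_of_le_of_eq ?_ (integral_add hadd habs')
  refine integral_mono_ae ((hQ.integrable_timeAbove x ht.le).const_mul _)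
    (hadd.add habs') ?_
  filter_upwards [hQ.ae_service_nonneg hG_nonneg, hQ.ae_interarrival_nonneg hA_nonneg]
    with ω hS hT
  have h₁ := timeAbove_le (D₀ := D₀) hx hT (hQ.measurable_workload_path ω) m t
  have h₂ : timeAbove D₀ S T x t ω ≤ t := by
    have h := (abs_le.1 (abs_timeAbove_sub_le (x := x) (hQ.measurable_workload_path ω) t 0)).2
    have h0 : timeAbove D₀ S T x 0 ω = 0 := intervalIntegral.integral_same
    rwa [h0, sub_zero, sub_zero, abs_of_pos ht] at h
  have h₃ : 0 ≤ ∑ n ∈ Finset.range m,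
      (max (delay D₀ S T n ω + S n ω - x) 0 - max (delay D₀ S T n ω - x) 0) :=
    Finset.sum_nonneg fun n _ => sub_nonneg.2 (max_le_max (by linarith [hS n]) le_rfl)
  have ht' := inv_pos.2 ht
  change t⁻¹ * timeAbove D₀ S T x t ω ≤ t⁻¹ * _ + min 1 _ + t⁻¹ * _
  have h₄ := mul_le_mul_of_nonneg_left h₁ ht'.le
  have h₅ := mul_le_mul_of_nonneg_left h₂ ht'.le
  rw [inv_mul_cancel₀ ht.ne'] at h₅
  have h₆ := mul_nonneg ht'.le h₃
  have h₇ := mul_nonneg ht'.le (abs_nonneg (t - arrivalTime T m ω))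
  rw [mul_add, mul_add] at h₄
  rcases le_total 1 (t⁻¹ * max (D₀ ω - x) 0) with h | h
  · simp only [min_eq_left h]
    linarith
  · simp only [min_eq_right h]
    linarith

/-- The matching lower bound for the mean fraction of time above `x`, with increments truncated at
`K`. -/
theorem IsInput.le_average_real_workload (hQ : IsInput P G A D₀ S T)
    (hG_nonneg : G (Set.Iio 0) = 0) (hA_nonneg : A (Set.Iio 0) = 0)
    (hG_int : Integrable (fun s => s) G) (hA_int : Integrable (fun t => t) A)
    {x K : ℝ} (hx : 0 ≤ x) (hK : 0 ≤ K) {t : ℝ} (ht : 0 < t) (m : ℕ) :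
    t⁻¹ * ∑ n ∈ Finset.range m, ∫ ω, (min (max (delay D₀ S T n ω + S n ω - x) 0) K
          - min (max (delay D₀ S T n ω - x) 0) K) ∂P
        - t⁻¹ * K - t⁻¹ * ∫ ω, |t - arrivalTime T m ω| ∂P
      ≤ t⁻¹ * ∫ ω, timeAbove D₀ S T x t ω ∂P := by
  have hinc := hQ.integrable_increment hG_int ((lipschitzWith_max_sub x).min_const K)
  have hsum : Integrable (fun ω => ∑ n ∈ Finset.range m,
      (min (max (delay D₀ S T n ω + S n ω - x) 0) K
        - min (max (delay D₀ S T n ω - x) 0) K)) P :=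
    integrable_finsetSum _ fun n _ => hinc n
  have habs : Integrable (fun ω => |t - arrivalTime T m ω|) P :=
    ((integrable_const t).sub (hQ.integrable_arrivalTime hA_int m)).abs
  rw [← integral_finsetSum _ fun n _ => hinc n, ← mul_sub, ← mul_sub]
  refine mul_le_mul_of_nonneg_left ?_ (inv_pos.2 ht).le
  have hsub := hsum.sub (integrable_const K)
  have hK' : ∫ _, K ∂P = K := by simp
  have h₁ := (integral_sub hsub habs).trans
    (congrArg (· - ∫ ω, |t - arrivalTime T m ω| ∂P) (integral_sub hsum (integrable_const K)))
  rw [hK'] at h₁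
  refine le_of_eq_of_le h₁.symm ?_
  refine integral_mono_ae (hsub.sub habs)
    (hQ.integrable_timeAbove x ht.le) ?_
  filter_upwards [hQ.ae_service_nonneg hG_nonneg, hQ.ae_interarrival_nonneg hA_nonneg,
    hQ.init_nonneg] with ω hS hT hD
  exact le_timeAbove hx hK hD hS hT (hQ.measurable_workload_path ω) m t

variable [IsProbabilityMeasure G]

/-- The mean increments of a Lipschitz function at the service-time jumps converge: `D_n` and
`S_n` are independent, and averaging over `S_n` leaves a bounded continuous function of `D_n`. -/
theorem IsInput.tendsto_integral_increment (hQ : IsInput P G A D₀ S T)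
    (hG_int : Integrable (fun s => s) G) (hA_int : Integrable (fun t => t) A)
    (hdrift : ∫ s, s ∂G < ∫ t, t ∂A) {δ : Measure ℝ} (hδ : IsEmptyStartLimit G A δ)
    {φ : ℝ → ℝ} (hφ : LipschitzWith 1 φ) :
    Tendsto (fun n => ∫ ω, (φ (delay D₀ S T n ω + S n ω) - φ (delay D₀ S T n ω)) ∂P) atTop
      (𝓝 (∫ d, ∫ s, (φ (d + s) - φ d) ∂G ∂δ)) := by
  have hbound : ∀ d s : ℝ, ‖φ (d + s) - φ d‖ ≤ ‖s‖ := fun d s => by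
    simpa [dist_eq_norm] using hφ.dist_le_mul (d + s) d
  have hφc := hφ.continuous
  have hc : Continuous fun d => ∫ s, (φ (d + s) - φ d) ∂G :=
    continuous_of_dominated (fun d => Continuous.aestronglyMeasurable (by fun_prop))
      (fun d => ae_of_all _ fun s => hbound d s) hG_int.norm (ae_of_all _ fun s => by fun_prop)
  have hF := hQ.tendsto_integral_delay hG_int hA_int hdrift hδ
    (BoundedContinuousFunction.ofNormedAddCommGroup _ hc (∫ s, ‖s‖ ∂G) fun d =>
      norm_integral_le_of_norm_le hG_int.norm (ae_of_all _ fun s => hbound d s))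
  refine hF.congr fun n => ?_
  have hpm : IsProbabilityMeasure (P.map (delay D₀ S T n)) :=
    Measure.isProbabilityMeasure_map (hQ.measurable_delay n).aemeasurable
  have hcont : Continuous fun p : ℝ × ℝ => φ (p.1 + p.2) - φ p.1 := by fun_prop
  have h := integral_map (μ := P) ((hQ.measurable_delay n).prodMk
    (hQ.measurable_service n)).aemeasurable hcont.aestronglyMeasurable
  rw [hQ.map_delay_service, integral_prod, integral_map (hQ.measurable_delay n).aemeasurable] at h
  · exact h
  · exact hc.aestronglyMeasurable
  · exact (hG_int.comp_snd (P.map (delay D₀ S T n))).mono hcont.aestronglyMeasurable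
      (ae_of_all _ fun p => hbound p.1 p.2)

/-- The long-run mean fraction of time above `x ≥ 0`: jumps lift `(V - x)⁺`, which then decreases
at unit rate exactly while `V > x`. -/
theorem IsInput.tendsto_average_real_workload (hQ : IsInput P G A D₀ S T)
    (hG_nonneg : G (Set.Iio 0) = 0) (hA_nonneg : A (Set.Iio 0) = 0)
    (hG_int : Integrable (fun s => s) G) (hA_int : Integrable (fun t => t) A)
    (hA_pos : 0 < ∫ t, t ∂A) (hdrift : ∫ s, s ∂G < ∫ t, t ∂A)
    {δ : Measure ℝ} [IsProbabilityMeasure δ] (hδ : IsEmptyStartLimit G A δ)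
    {x : ℝ} (hx : 0 ≤ x) :
    Tendsto (fun t : ℝ => t⁻¹ * ∫ s in (0 : ℝ)..t, P.real {ω | x < workload D₀ S T s ω}) atTop
      (𝓝 ((∫ t, t ∂A)⁻¹ * ∫ d, ∫ s, (max (d + s - x) 0 - max (d - x) 0) ∂G ∂δ)) := by
  have hJ : Tendsto (fun t : ℝ => t⁻¹ * ∫ ω, timeAbove D₀ S T x t ω ∂P) atTop
      (𝓝 ((∫ t, t ∂A)⁻¹ * ∫ d, ∫ s, (max (d + s - x) 0 - max (d - x) 0) ∂G ∂δ)) := by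
    have herr := hQ.tendsto_integral_abs_sub_arrivalTime hA_int hA_pos
    refine tendsto_order.2 ⟨fun b hb => ?_, fun b hb => ?_⟩
    · have hlimK : Tendsto (fun K : ℕ => (∫ t, t ∂A)⁻¹ * ∫ d, ∫ s,
          (min (max (d + s - x) 0) (K : ℝ) - min (max (d - x) 0) (K : ℝ)) ∂G ∂δ) atTop
          (𝓝 ((∫ t, t ∂A)⁻¹ * ∫ d, ∫ s, (max (d + s - x) 0 - max (d - x) 0) ∂G ∂δ)) := by
        have hbd : ∀ (K : ℕ) (d s : ℝ),
            ‖min (max (d + s - x) 0) (K : ℝ) - min (max (d - x) 0) (K : ℝ)‖ ≤ ‖s‖ :=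
          fun K d s => by
            simpa [dist_eq_norm] using
              ((lipschitzWith_max_sub x).min_const (K : ℝ)).dist_le_mul (d + s) d
        have hstab : ∀ v : ℝ, Tendsto (fun K : ℕ => min v (K : ℝ)) atTop (𝓝 v) := fun v =>
          tendsto_const_nhds.congr' (by
            filter_upwards [eventually_ge_atTop ⌈v⌉₊] with K hK
            rw [min_eq_left (Nat.ceil_le.1 hK)])
        refine Tendsto.const_mul _ (tendsto_integral_of_dominated_convergence
          (fun _ => ∫ s, ‖s‖ ∂G) (fun K => ?_) (integrable_const _)
          (fun K => ae_of_all _ fun d => norm_integral_le_of_norm_le hG_int.norm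
            (ae_of_all _ fun s => hbd K d s))
          (ae_of_all _ fun d => tendsto_integral_of_dominated_convergence (fun s => ‖s‖)
            (fun K => Continuous.aestronglyMeasurable (by fun_prop)) hG_int.norm
            (fun K => ae_of_all _ fun s => hbd K d s)
            (ae_of_all _ fun s => (hstab _).sub (hstab _))))
        have hc : Continuous fun p : ℝ × ℝ =>
            min (max (p.1 + p.2 - x) 0) (K : ℝ) - min (max (p.1 - x) 0) (K : ℝ) := by fun_prop
        exact (hc.stronglyMeasurable.integral_prod_right' (ν := G)).aestronglyMeasurable
      -- choose the truncation level first, then let `t → ∞` for this fixed level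
      obtain ⟨K, hK⟩ := ((tendsto_order.1 hlimK).1 b hb).exists
      have hlow := ((tendsto_average_meanArrivals hA_pos (hQ.tendsto_integral_increment hG_int
        hA_int hdrift hδ ((lipschitzWith_max_sub x).min_const (K : ℝ)))).sub
        ((tendsto_inv_atTop_zero (𝕜 := ℝ)).mul_const (K : ℝ))).sub herr
      rw [zero_mul, sub_zero, sub_zero] at hlow
      filter_upwards [(tendsto_order.1 hlow).1 b hK, eventually_gt_atTop 0] with t h ht
      exact h.trans_le (hQ.le_average_real_workload hG_nonneg hA_nonneg hG_int hA_int hx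
        (Nat.cast_nonneg K) ht _)
    · have hup := ((tendsto_average_meanArrivals hA_pos (hQ.tendsto_integral_increment hG_int
        hA_int hdrift hδ (lipschitzWith_max_sub x))).add (hQ.tendsto_integral_min_init x)).add herr
      rw [add_zero, add_zero] at hup
      filter_upwards [(tendsto_order.1 hup).2 b hb, eventually_gt_atTop 0] with t h ht
      exact (hQ.average_real_workload_le hG_nonneg hA_nonneg hG_int hA_int hx ht _).trans_lt h
  refine hJ.congr' ?_
  filter_upwards [eventually_ge_atTop 0] with t ht
  rw [hQ.integral_real_workload x ht]

end Workload

/-! ### The time-stationary workload -/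

/-- The law of the variable that is `D + S_e` with probability `ρ` and `0` otherwise, where
`D ∼ δ` and `S_e ∼ η` are independent. -/
noncomputable def zeroOrSumLaw (ρ : ℝ) (δ η : Measure ℝ) : Measure ℝ :=
  ENNReal.ofReal (1 - ρ) • Measure.dirac 0 + ENNReal.ofReal ρ • Measure.conv δ η

section ZeroOrSum

variable {ρ : ℝ} {δ η : Measure ℝ}

theorem isProbabilityMeasure_zeroOrSumLaw [IsProbabilityMeasure δ] [IsProbabilityMeasure η]
    (h₀ : 0 ≤ ρ) (h₁ : ρ ≤ 1) :
    IsProbabilityMeasure (zeroOrSumLaw ρ δ η) := by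
  refine ⟨?_⟩
  have hc : (Measure.conv δ η) Set.univ = 1 := measure_univ
  simp only [zeroOrSumLaw, Measure.add_apply, Measure.smul_apply, smul_eq_mul, measure_univ, hc,
    mul_one]
  rw [← ENNReal.ofReal_add (by linarith) h₀]
  simp

theorem zeroOrSumLaw_apply {s : Set ℝ} (hs : MeasurableSet s) :
    zeroOrSumLaw ρ δ η s = ENNReal.ofReal (1 - ρ) * s.indicator 1 (0 : ℝ)
      + ENNReal.ofReal ρ * (δ.prod η) {p | p.1 + p.2 ∈ s} := by
  rw [zeroOrSumLaw, Measure.add_apply, Measure.smul_apply, Measure.smul_apply, smul_eq_mul,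
    smul_eq_mul, Measure.dirac_apply' _ hs, Measure.conv, Measure.map_apply (by fun_prop) hs]
  rfl

theorem zeroOrSumLaw_real_Ioi (h₀ : 0 ≤ ρ) {x : ℝ} (hx : 0 ≤ x) :
    (zeroOrSumLaw ρ δ η).real (Set.Ioi x) = ρ * (δ.prod η).real {p | x < p.1 + p.2} := by
  rw [measureReal_def, zeroOrSumLaw_apply measurableSet_Ioi]
  simp [hx, h₀, measureReal_def]

theorem zeroOrSumLaw_Iic_of_neg (hδ : ∀ᵐ d ∂δ, 0 ≤ d) (hη : ∀ᵐ s ∂η, 0 ≤ s) {x : ℝ}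
    (hx : x < 0) : zeroOrSumLaw ρ δ η (Set.Iic x) = 0 := by
  have h : (δ.prod η) {p | p.1 + p.2 ∈ Set.Iic x} = 0 := by
    rw [← compl_compl {p : ℝ × ℝ | p.1 + p.2 ∈ Set.Iic x}, ← mem_ae_iff]
    filter_upwards [Measure.quasiMeasurePreserving_fst.ae hδ,
      Measure.quasiMeasurePreserving_snd.ae hη] with p h₁ h₂
    simp only [Set.mem_Iic, Set.mem_compl_iff, Set.mem_ofPred_eq, not_le]
    linarith
  rw [zeroOrSumLaw_apply measurableSet_Iic, h]
  simp [hx]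

theorem bind_bind_dirac_add [IsProbabilityMeasure η] :
    δ.bind (fun d => η.bind fun s => Measure.dirac (d + s)) = Measure.conv δ η := by
  have hinner : ∀ d : ℝ, (η.bind fun s => Measure.dirac (d + s)) = η.map (fun s => d + s) :=
    fun d => Measure.bind_dirac_eq_map η (by fun_prop)
  simp only [hinner]
  have hm : Measurable fun d : ℝ => η.map (fun s => d + s) := by
    refine Measure.measurable_of_measurable_coe _ fun s hs => ?_
    simp only [Measure.map_apply (measurable_const_add _) hs]
    exact measurable_measure_prodMk_left (ν := η)
      ((measurable_fst.add measurable_snd) hs : MeasurableSet {p : ℝ × ℝ | p.1 + p.2 ∈ s})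
  ext s hs
  have hs' : MeasurableSet ((fun p : ℝ × ℝ => p.1 + p.2) ⁻¹' s) :=
    (measurable_fst.add measurable_snd) hs
  rw [Measure.bind_apply hs hm.aemeasurable, Measure.conv, Measure.map_apply (by fun_prop) hs,
    Measure.prod_apply hs']
  refine lintegral_congr fun d => ?_
  rw [Measure.map_apply (measurable_const_add _) hs]
  rfl

/-- The procedure draws a uniform variate `u` and mixes the law of `D + S_e` over `u < ρ` with the
point mass at `0` over `ρ ≤ u`. -/
theorem outputLaw_workloadProcedure {G : Measure ℝ} {δ : ProbabilityMeasure ℝ}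
    [IsProbabilityMeasure (equilibrium G)] (h₀ : 0 ≤ ρ) (h₁ : ρ ≤ 1) :
    workloadProcedure.outputLaw (Source.dist δ G) (known ρ)
      = zeroOrSumLaw ρ δ (equilibrium G) := by
  have hunfold : workloadProcedure.outputLaw (Source.dist δ G) (known ρ)
      = (volume.restrict (Set.Icc (0 : ℝ) 1)).bind fun u =>
        if u < ρ then Measure.conv (δ : Measure ℝ) (equilibrium G) else Measure.dirac 0 := by
    simp only [workloadProcedure, Procedure.outputLaw]
    congr 1
    funext u
    rw [← bind_bind_dirac_add]
    simp [Expr.eval, known, Source.dist, Function.update_of_ne]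
  rw [hunfold]
  ext s hs
  rw [Measure.bind_apply hs
    (Measurable.ite measurableSet_Iio measurable_const measurable_const).aemeasurable,
    ← lintegral_add_compl _ (measurableSet_Iio (a := ρ)),
    setLIntegral_congr_fun (g := fun _ => Measure.conv (δ : Measure ℝ) (equilibrium G) s)
      measurableSet_Iio (fun u (hu : u < ρ) => by simp only [if_pos hu]),
    setLIntegral_congr_fun (g := fun _ => Measure.dirac (0 : ℝ) s)
      measurableSet_Iio.compl (fun u (hu : ¬ u < ρ) => by simp only [if_neg hu]),
    setLIntegral_const, setLIntegral_const, Measure.restrict_apply measurableSet_Iio,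
    Measure.restrict_apply measurableSet_Iio.compl]
  have hlow : Set.Iio ρ ∩ Set.Icc 0 1 = Set.Ico 0 ρ := by
    ext u
    simp only [Set.mem_inter_iff, Set.mem_Iio, Set.mem_Icc, Set.mem_Ico]
    constructor
    · exact fun h => ⟨h.2.1, h.1⟩
    · exact fun h => ⟨h.2, h.1, by linarith⟩
  have hhigh : (Set.Iio ρ)ᶜ ∩ Set.Icc 0 1 = Set.Icc ρ 1 := by
    ext u
    simp only [Set.mem_inter_iff, Set.mem_compl_iff, Set.mem_Iio, not_lt, Set.mem_Icc]
    constructor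
    · exact fun h => ⟨h.1, h.2.2⟩
    · exact fun h => ⟨h.1, by linarith, h.2⟩
  rw [hlow, hhigh, Real.volume_Ico, Real.volume_Icc, sub_zero, zeroOrSumLaw, Measure.add_apply,
    Measure.smul_apply, Measure.smul_apply, smul_eq_mul, smul_eq_mul, add_comm, mul_comm,
    mul_comm (ENNReal.ofReal ρ)]

theorem map_ite_add_eq_zeroOrSumLaw {Ω' : Type*} [MeasurableSpace Ω'] {P' : Measure Ω'}
    [IsProbabilityMeasure P'] {B : Ω' → Bool} {D Se : Ω' → ℝ} (hB : Measurable B)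
    (hD : Measurable D) (hSe : Measurable Se) (hBlaw : P'.real {ω | B ω = true} = ρ)
    (hDlaw : P'.map D = δ) (hSelaw : P'.map Se = η) (hDSe : IndepFun D Se P')
    (hBDSe : IndepFun B (fun ω => (D ω, Se ω)) P') :
    P'.map (fun ω => if B ω = true then D ω + Se ω else 0) = zeroOrSumLaw ρ δ η := by
  have hBt : MeasurableSet (B ⁻¹' {true}) := hB (measurableSet_singleton _)
  have hf : Measurable fun ω => if B ω = true then D ω + Se ω else 0 :=
    Measurable.ite hBt (hD.add hSe) measurable_const
  have hpair : P'.map (fun ω => (D ω, Se ω)) = δ.prod η := by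
    rw [← hDlaw, ← hSelaw]
    exact (indepFun_iff_map_prod_eq_prod_map_map hD.aemeasurable hSe.aemeasurable).1 hDSe
  have hlaw : P' (B ⁻¹' {true}) = ENNReal.ofReal ρ := by
    rw [← hBlaw, ofReal_measureReal]
    rfl
  have hlaw' : P' (B ⁻¹' {true})ᶜ = ENNReal.ofReal (1 - ρ) := by
    rw [prob_compl_eq_one_sub hBt, hlaw, ENNReal.ofReal_sub _ (hBlaw ▸ measureReal_nonneg),
      ENNReal.ofReal_one]
  ext s hs
  have hs' : MeasurableSet {p : ℝ × ℝ | p.1 + p.2 ∈ s} := (measurable_fst.add measurable_snd) hs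
  rw [Measure.map_apply hf hs, zeroOrSumLaw_apply hs, ← measure_inter_add_sdiff _ hBt, add_comm]
  congr 1
  · by_cases h0 : (0 : ℝ) ∈ s
    · have hset : (fun ω => if B ω = true then D ω + Se ω else 0) ⁻¹' s \ B ⁻¹' {true}
          = (B ⁻¹' {true})ᶜ := by
        ext ω
        by_cases hω : B ω = true <;> simp [h0, hω]
      simp [hset, h0, hlaw']
    · have hset : (fun ω => if B ω = true then D ω + Se ω else 0) ⁻¹' s \ B ⁻¹' {true} = ∅ := by
        ext ω
        by_cases hω : B ω = true <;> simp [h0, hω]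
      simp [hset, h0]
  · have hset : (fun ω => if B ω = true then D ω + Se ω else 0) ⁻¹' s ∩ B ⁻¹' {true}
        = B ⁻¹' {true} ∩ (fun ω => (D ω, Se ω)) ⁻¹' {p : ℝ × ℝ | p.1 + p.2 ∈ s} := by
      ext ω
      by_cases hω : B ω = true <;> simp [hω]
    rw [hset, hBDSe.measure_inter_preimage_eq_mul _ _ (measurableSet_singleton _) hs', hlaw,
      ← hpair, Measure.map_apply (hD.prodMk hSe) hs']

end ZeroOrSum

theorem ae_equilibrium_nonneg (G : Measure ℝ) : ∀ᵐ s ∂(equilibrium G), 0 ≤ s :=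
  (withDensity_absolutelyContinuous _ _).ae_le (ae_restrict_mem measurableSet_Ici)

theorem IsTimeStationaryWorkloadLaw.unique {Ω : Type*} [MeasurableSpace Ω] {P : Measure Ω}
    {D₀ : Ω → ℝ} {S T : ℕ → Ω → ℝ} {ν ν' : ProbabilityMeasure ℝ}
    (hν : IsTimeStationaryWorkloadLaw P D₀ S T ν)
    (hν' : IsTimeStationaryWorkloadLaw P D₀ S T ν') : ν = ν' := by
  refine Subtype.ext (Measure.ext_of_Iic (ν : Measure ℝ) ν' fun x => ?_)
  rw [← ofReal_measureReal, ← ofReal_measureReal, tendsto_nhds_unique (hν x) (hν' x)]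

/-- Averaged over time, the laws of the workload converge pointwise as distribution functions to the
mixture of `0` and `D + S_e`. -/
theorem IsInput.isTimeStationaryWorkloadLaw {Ω : Type*} [MeasurableSpace Ω] {P : Measure Ω}
    [IsProbabilityMeasure P] {G A : Measure ℝ} [IsProbabilityMeasure G] [IsProbabilityMeasure A]
    {D₀ : Ω → ℝ} {S T : ℕ → Ω → ℝ} (hQ : IsInput P G A D₀ S T)
    (hG_nonneg : G (Set.Iio 0) = 0) (hA_nonneg : A (Set.Iio 0) = 0)
    (hG_int : Integrable (fun s => s) G) (hA_int : Integrable (fun t => t) A)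
    (hG_pos : 0 < ∫ s, s ∂G) (hA_pos : 0 < ∫ t, t ∂A) (hdrift : ∫ s, s ∂G < ∫ t, t ∂A)
    {δ ν : ProbabilityMeasure ℝ} (hδ : IsEmptyStartLimit G A δ)
    (hν : (ν : Measure ℝ) = zeroOrSumLaw (trafficIntensity G A) δ (equilibrium G)) :
    IsTimeStationaryWorkloadLaw P D₀ S T ν := by
  have hE := isProbabilityMeasure_equilibrium hG_nonneg hG_int hG_pos
  have hρ₀ : 0 ≤ trafficIntensity G A := div_nonneg hG_pos.le hA_pos.le
  intro x
  rcases lt_or_ge x 0 with hx | hx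
  · have hempty : ∀ s, {ω | workload D₀ S T s ω ≤ x} = ∅ := fun s =>
      Set.eq_empty_of_forall_notMem fun ω => not_le.2 (hx.trans_le (le_max_right _ _))
    rw [measureReal_def, hν, zeroOrSumLaw_Iic_of_neg hδ.isStationaryDelayLaw.ae_nonneg
      (ae_equilibrium_nonneg G) hx]
    simp [hempty]
  · have hlim := hQ.tendsto_average_real_workload hG_nonneg hA_nonneg hG_int hA_int hA_pos hdrift
      hδ hx
    have hset : ∀ s, MeasurableSet {ω | x < workload D₀ S T s ω} := fun s =>
      measurableSet_lt measurable_const (hQ.measurable_workload_time s)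
    have hval : (ν : Measure ℝ).real (Set.Iic x) = 1 - (∫ t, t ∂A)⁻¹
        * ∫ d, ∫ s, (max (d + s - x) 0 - max (d - x) 0) ∂G ∂(δ : Measure ℝ) := by
      rw [← Set.compl_Ioi, probReal_compl_eq_one_sub measurableSet_Ioi, hν,
        zeroOrSumLaw_real_Ioi hρ₀ hx,
        ← integral_mul_prod_equilibrium_real hG_nonneg hG_int hG_pos, trafficIntensity]
      ring
    rw [hval]
    refine (hlim.const_sub 1).congr' ?_
    filter_upwards [eventually_gt_atTop 0] with t ht
    have hcompl : ∀ s, P.real {ω | workload D₀ S T s ω ≤ x}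
        = 1 - P.real {ω | x < workload D₀ S T s ω} := fun s => by
      rw [← probReal_compl_eq_one_sub (hset s)]
      congr 1
      ext ω
      simp
    have hmeas : Measurable fun s => P.real {ω | x < workload D₀ S T s ω} :=
      (measurable_measure_prodMk_left (ν := P) (measurableSet_lt measurable_const
        hQ.measurable_workload :
          MeasurableSet {p : ℝ × Ω | x < workload D₀ S T p.1 p.2})).ennreal_toReal
    have hii : IntervalIntegrable (fun s => P.real {ω | x < workload D₀ S T s ω}) volume 0 t := by
      refine (intervalIntegrable_const (c := (1 : ℝ))).mono_fun' hmeas.aestronglyMeasurable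
        (ae_of_all _ fun s => ?_)
      exact (Real.norm_of_nonneg measureReal_nonneg).trans_le measureReal_le_one
    simp only [hcompl]
    rw [intervalIntegral.integral_sub (by simp) hii, intervalIntegral.integral_const, smul_eq_mul,
      mul_one, sub_zero]
    field_simp

end GIGI1

theorem mainTheorem4
    {Ω : Type*} [MeasurableSpace Ω] (P : Measure Ω) [IsProbabilityMeasure P]
    -- service-time law `G` and interarrival-time law `A` on `[0, ∞)`, with finite nonzero means
    (G A : Measure ℝ) [IsProbabilityMeasure G] [IsProbabilityMeasure A]
    (hG_nonneg : G (Set.Iio 0) = 0) (hA_nonneg : A (Set.Iio 0) = 0)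
    (hG_int : Integrable (fun s => s) G) (hA_int : Integrable (fun t => t) A)
    (hG_pos : 0 < ∫ s, s ∂G) (hA_pos : 0 < ∫ t, t ∂A)
    -- stability
    (hρ : GIGI1.trafficIntensity G A < 1)
    (D₀ : Ω → ℝ) (S T : ℕ → Ω → ℝ) (hQ : GIGI1.IsInput P G A D₀ S T) :
    -- the stationary laws exist and are unique
    (∃! δ : ProbabilityMeasure ℝ, GIGI1.IsStationaryDelayLaw G A δ) ∧
    (∃! ν : ProbabilityMeasure ℝ, GIGI1.IsTimeStationaryWorkloadLaw P D₀ S T ν) ∧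
    ∀ δ ν : ProbabilityMeasure ℝ, GIGI1.IsStationaryDelayLaw G A δ →
      GIGI1.IsTimeStationaryWorkloadLaw P D₀ S T ν →
      -- the stationary delay law is the limiting law of the delays `D_n`
      TendstoInDistribution (GIGI1.delay D₀ S T) atTop (fun d : ℝ => d)
        (fun _ => P) (δ : Measure ℝ) ∧
      -- `G_e` is a probability distribution
      IsProbabilityMeasure (GIGI1.equilibrium G) ∧
      -- `P(V > x) = ρ P(D + S_e > x)`
      (∀ x : ℝ, 0 ≤ x → (ν : Measure ℝ).real (Set.Ioi x) =
        GIGI1.trafficIntensity G A *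
          ((δ : Measure ℝ).prod (GIGI1.equilibrium G)).real {p : ℝ × ℝ | x < p.1 + p.2}) ∧
      -- `V ∼ (1 - ρ) δ_0 + ρ F_D ∗ G_e`
      (ν : Measure ℝ) =
        ENNReal.ofReal (1 - GIGI1.trafficIntensity G A) • Measure.dirac (0 : ℝ) +
        ENNReal.ofReal (GIGI1.trafficIntensity G A) •
          (Measure.conv (δ : Measure ℝ) (GIGI1.equilibrium G)) ∧
      -- the procedure, given `ρ` and samples of `D` and `G_e`, outputs an exact copy of `V`
      GIGI1.Procedure.outputLaw (GIGI1.Source.dist δ G) GIGI1.workloadProcedure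
        (GIGI1.known (GIGI1.trafficIntensity G A)) = (ν : Measure ℝ) ∧
      -- the same in terms of random variables: `B ∼ Bernoulli(ρ)`, `D`, `S_e` independent
      (∀ (Ω' : Type*) [MeasurableSpace Ω'] (P' : Measure Ω') [IsProbabilityMeasure P']
        (B : Ω' → Bool) (D Se : Ω' → ℝ), Measurable B → Measurable D → Measurable Se →
        P'.real {ω | B ω = true} = GIGI1.trafficIntensity G A →
        P'.map D = (δ : Measure ℝ) → P'.map Se = GIGI1.equilibrium G →
        IndepFun D Se P' → IndepFun B (fun ω => (D ω, Se ω)) P' →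
        P'.map (fun ω => if B ω = true then D ω + Se ω else 0) = (ν : Measure ℝ)) := by
  have hdrift : ∫ s, s ∂G < ∫ t, t ∂A := by
    rwa [GIGI1.trafficIntensity, div_lt_one hA_pos] at hρ
  have hρ₀ : 0 ≤ GIGI1.trafficIntensity G A := div_nonneg hG_pos.le hA_pos.le
  have hE := GIGI1.isProbabilityMeasure_equilibrium hG_nonneg hG_int hG_pos
  obtain ⟨δ₀, hδ₀⟩ := hQ.exists_isEmptyStartLimit hG_int hA_int hdrift
  have hδ_unique : ∀ δ, GIGI1.IsStationaryDelayLaw G A δ → δ = δ₀ := fun δ hδ =>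
    hQ.eq_of_isStationaryDelayLaw hG_int hA_int hdrift hδ₀ hδ
  let ν₀ : ProbabilityMeasure ℝ :=
    ⟨GIGI1.zeroOrSumLaw (GIGI1.trafficIntensity G A) δ₀ (GIGI1.equilibrium G),
      GIGI1.isProbabilityMeasure_zeroOrSumLaw hρ₀ hρ.le⟩
  have hν₀ : GIGI1.IsTimeStationaryWorkloadLaw P D₀ S T ν₀ :=
    hQ.isTimeStationaryWorkloadLaw hG_nonneg hA_nonneg hG_int hA_int hG_pos hA_pos hdrift hδ₀ rfl
  refine ⟨⟨δ₀, hδ₀.isStationaryDelayLaw, hδ_unique⟩, ⟨ν₀, hν₀, fun ν hν => hν.unique hν₀⟩, ?_⟩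
  intro δ ν hδ hν
  obtain rfl := hδ_unique δ hδ
  obtain rfl := hν.unique hν₀
  refine ⟨hQ.tendstoInDistribution_delay hG_int hA_int hdrift hδ₀, hE,
    fun x hx => GIGI1.zeroOrSumLaw_real_Ioi hρ₀ hx, rfl,
    GIGI1.outputLaw_workloadProcedure hρ₀ hρ.le, ?_⟩
  intro Ω' _ P' _ B D Se hB hD hSe hBlaw hDlaw hSelaw hDSe hBDSe
  exact GIGI1.map_ite_add_eq_zeroOrSumLaw hB hD hSe hBlaw hDlaw hSelaw hDSe hBDSe
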